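/- A toric K\"ahler surface is a smooth 4-manifold $B$ with a K\"ahler structure (metric $h$, complex structure $I$, K\"ahler form $J=h(I\cdot,\cdot)$) and two commuting holomorphic Killing fields $m_1,m_2$ with complete $2\pi$-periodic flows and moment maps $x_1,x_2$, $\iota_{m_i}J=-\mathrm{d}x_i$. Its axis is the set $\{\det h(m_i,m_j)=0\}$. Let $U\subset B$ be a nonempty connected open set disjoint from the axis. Smooth functions $\xi,\eta$ on $U$ with $m_i\xi=m_i\eta=0$, with $\mathrm{d}\xi$ and $\mathrm{d}\eta$ nowhere zero and $\mathrm{d}\xi\cdot\mathrm{d}\eta=0$ are called orthogonal coordinates. For a torus-invariant function $f$ the partial derivatives are defined by $\mathrm{d}f=\partial_\xi f\,\mathrm{d}\xi+\partial_\eta f\,\mathrm{d}\eta$. The structure is separable on $U$ with respect to $(\xi,\eta)$ if $\partial_\xi^2x_i=\partial_\eta^2x_i=0$ for $i=1,2$. Put $\Omega=\partial_\xi x_1\,\partial_\eta x_2-\partial_\xi x_2\,\partial_\eta x_1$. Relative to $(\xi,\eta)$ the structure is product-toric (PT) if $\partial_\xi\Omega$ and $\partial_\eta\Omega$ both vanish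 identically on $U$; Calabi-toric (CT) if one of them vanishes identically and the other vanishes nowhere on $U$; ortho-toric (OT) if both vanish nowhere on $U$. Proposition. Let a toric K\"ahler surface be separable on $U$ with respect to $(\xi,\eta)$. Then, relative to $(\xi,\eta)$, it belongs to exactly one of the classes PT, CT, OT. Moreover, after affine changes $\xi\mapsto K_\xi\xi+C_\xi$, $\eta\mapsto K_\eta\eta+C_\eta$ with $K_\xi,K_\eta\neq0$, and possibly an exchange of the two coordinates (the new coordinates are again called $\xi,\eta$), there are an invertible constant matrix $A$ and constants $k_i$ such that, with $$(\Sigma,P,Q)=\begin{cases}(1,\ \xi,\ \eta)&\text{PT}\\(\xi,\ \xi,\ \xi\eta)&\text{CT}\\(\xi-\eta,\ \xi+\eta,\ \xi\eta)&\text{OT}\end{cases}$$ one has on $U$: $x_i=k_i+A_{1i}P+A_{2i}Q$, and the Jacobian of $(\xi,\eta)\mapsto(x_1,x_2)$ is $N\Sigma$ for a nonzero constant $N$. Every point of $U$ has a neighbourhood in $U$ with local coordinates $(\xi,\eta,\psi,\varphi)$, in which $m_i=A_{1i}\partial_\psi+A_{2i}\partial_\varphi$ (so $\partial_\psi,\partial_\varphi$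 is a basis of the toric Killing fields), and smooth functions $F(\xi)$, $G(\eta)$ of a single variable, with $\Sigma,F,G$ nowhere zero, such that $$h=\Sigma\Big(\frac{\mathrm{d}\xi^2}{F(\xi)}+\frac{\mathrm{d}\eta^2}{G(\eta)}\Big)+\frac1\Sigma\Big(F(\xi)\sigma_\xi^2+G(\eta)\sigma_\eta^2\Big),\qquad J=\mathrm{d}\big(P\,\mathrm{d}\psi+Q\,\mathrm{d}\varphi\big),$$ where $\sigma_\xi=\mathrm{d}\psi,\ \mathrm{d}\psi+\eta\,\mathrm{d}\varphi,\ \mathrm{d}\psi+\eta\,\mathrm{d}\varphi$ and $\sigma_\eta=\mathrm{d}\varphi,\ \xi\,\mathrm{d}\varphi,\ \mathrm{d}\psi+\xi\,\mathrm{d}\varphi$ in the cases PT, CT, OT respectively. -/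

import Mathlib

open scoped Manifold ContDiff

noncomputable section

/-- The model space `ℝ⁴`. -/
abbrev E4 : Type := EuclideanSpace ℝ (Fin 4)

/-- The model with corners of a 4-manifold without boundary. -/
abbrev I4 : ModelWithCorners ℝ E4 E4 := 𝓘(ℝ, E4)

section Manifold

variable {M : Type*} [TopologicalSpace M] [ChartedSpace E4 M]

/-- The differential `df` at `p` of a real function `f`, as a covector. -/
def dif (f : M → ℝ) (p : M) : TangentSpace I4 p →L[ℝ] ℝ :=
  mfderiv I4 𝓘(ℝ, ℝ) f p

/-- The wedge product `α ∧ β` of two covectors, evaluated on two vectors. -/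
def wedge {p : M} (α β : TangentSpace I4 p →L[ℝ] ℝ) (v w : TangentSpace I4 p) : ℝ :=
  α v * β w - α w * β v

/-- `X` is a smooth vector field near `p`. -/
def SmoothFieldAt [IsManifold I4 ∞ M] (X : (q : M) → TangentSpace I4 q) (p : M) : Prop :=
  ContMDiffAt I4 I4.tangent ∞ (fun q => (⟨q, X q⟩ : TangentBundle I4 M)) p

end Manifold

/-- A Kähler structure on a smooth 4-manifold `M`: a Riemannian metric `h`, an integrable orthogonal
almost complex structure `I`, and closed Kähler form `J(v, w) = h(I v, w)`. -/
structure KahlerSurface (M : Type*) [TopologicalSpace M] [ChartedSpace E4 M]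
    [IsManifold I4 ∞ M] where
  /-- the Riemannian metric `h` -/
  metric : Bundle.ContMDiffRiemannianMetric I4 ∞ E4 (fun p : M => TangentSpace I4 p)
  /-- the complex structure `I` -/
  cplx : (p : M) → (TangentSpace I4 p →L[ℝ] TangentSpace I4 p)
  cplx_smooth : ContMDiff I4 (I4.prod 𝓘(ℝ, E4 →L[ℝ] E4)) ∞
    (fun p => Bundle.TotalSpace.mk' (E4 →L[ℝ] E4)
      (E := fun p : M => (TangentSpace I4 p →L[ℝ] TangentSpace I4 p)) p (cplx p))
  cplx_sq : ∀ (p : M) (v : TangentSpace I4 p), cplx p (cplx p v) = -v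
  cplx_isometry : ∀ (p : M) (v w : TangentSpace I4 p),
    metric.inner p (cplx p v) (cplx p w) = metric.inner p v w
  /-- the Nijenhuis tensor of `I` vanishes -/
  integrable : ∀ (p : M) (X Y : (q : M) → TangentSpace I4 q),
    SmoothFieldAt X p → SmoothFieldAt Y p →
      VectorField.mlieBracket I4 (fun q => cplx q (X q)) (fun q => cplx q (Y q)) p
        - cplx p (VectorField.mlieBracket I4 (fun q => cplx q (X q)) Y p)
        - cplx p (VectorField.mlieBracket I4 X (fun q => cplx q (Y q)) p)
        - VectorField.mlieBracket I4 X Y p = 0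
  /-- the Kähler form is closed, `dJ(X, Y, Z) = 0` -/
  closed : ∀ (p : M) (X Y Z : (q : M) → TangentSpace I4 q),
    SmoothFieldAt X p → SmoothFieldAt Y p → SmoothFieldAt Z p →
      dif (fun q => metric.inner q (cplx q (Y q)) (Z q)) p (X p)
        + dif (fun q => metric.inner q (cplx q (Z q)) (X q)) p (Y p)
        + dif (fun q => metric.inner q (cplx q (X q)) (Y q)) p (Z p)
        - metric.inner p (cplx p (VectorField.mlieBracket I4 X Y p)) (Z p)
        - metric.inner p (cplx p (VectorField.mlieBracket I4 Y Z p)) (X p)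
        - metric.inner p (cplx p (VectorField.mlieBracket I4 Z X p)) (Y p) = 0

/-- A toric Kähler surface: a Kähler surface with two commuting holomorphic Killing fields `m₁, m₂`
whose flows are complete and `2π`-periodic (so that they generate an action of the 2-torus) and
which are Hamiltonian, with moment maps `x₁, x₂`. -/
structure ToricKahlerSurface (M : Type*) [TopologicalSpace M] [ChartedSpace E4 M]
    [IsManifold I4 ∞ M] extends KahlerSurface M where
  /-- the toric Killing fields -/
  m : Fin 2 → (p : M) → TangentSpace I4 p
  m_smooth : ∀ (i : Fin 2) (p : M), SmoothFieldAt (m i) p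
  m_comm : ∀ (i j : Fin 2) (p : M), VectorField.mlieBracket I4 (m i) (m j) p = 0
  m_periodic : ∀ (i : Fin 2) (p : M), ∃ γ : ℝ → M,
    γ 0 = p ∧ IsMIntegralCurve (I := I4) γ (m i) ∧ Function.Periodic γ (2 * Real.pi)
  /-- `m i` is a Killing field, `L_{m i} h = 0` -/
  m_killing : ∀ (i : Fin 2) (p : M) (X Y : (q : M) → TangentSpace I4 q),
    SmoothFieldAt X p → SmoothFieldAt Y p →
      dif (fun q => metric.inner q (X q) (Y q)) p (m i p)
        = metric.inner p (VectorField.mlieBracket I4 (m i) X p) (Y p)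
          + metric.inner p (X p) (VectorField.mlieBracket I4 (m i) Y p)
  /-- `m i` is holomorphic, `L_{m i} I = 0` -/
  m_holomorphic : ∀ (i : Fin 2) (p : M) (X : (q : M) → TangentSpace I4 q), SmoothFieldAt X p →
    VectorField.mlieBracket I4 (m i) (fun q => cplx q (X q)) p
      = cplx p (VectorField.mlieBracket I4 (m i) X p)
  /-- the moment maps -/
  x : Fin 2 → M → ℝ
  x_smooth : ∀ i : Fin 2, ContMDiff I4 𝓘(ℝ, ℝ) ∞ (x i)
  /-- `ι_{m i} J = -d x_i` -/
  hamiltonian : ∀ (i : Fin 2) (p : M) (v : TangentSpace I4 p),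
    metric.inner p (cplx p (m i p)) v = -(dif (x i) p v)

/-- The three classes of separable structures. -/
inductive SepClass : Type
  /-- product-toric -/
  | PT
  /-- Calabi-toric -/
  | CT
  /-- ortho-toric -/
  | OT

namespace SepClass

/-- The function `Σ(ξ, η)`. -/
def Sig : SepClass → ℝ → ℝ → ℝ
  | PT, _, _ => 1
  | CT, s, _ => s
  | OT, s, t => s - t

/-- The coefficient of `dψ` in the potential `P dψ + Q dφ` of the Kähler form. -/
def P : SepClass → ℝ → ℝ → ℝ
  | PT, s, _ => s
  | CT, s, _ => s
  | OT, s, t => s + t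

/-- The coefficient of `dφ` in the potential `P dψ + Q dφ` of the Kähler form. -/
def Q : SepClass → ℝ → ℝ → ℝ
  | PT, _, t => t
  | CT, s, t => s * t
  | OT, s, t => s * t

/-- The 1-form `σ_ξ` at a point where the second coordinate is `η = t`. -/
def sigXi {V : Type*} [AddCommGroup V] [Module ℝ V] (c : SepClass) (t : ℝ) (dψ dφ : V) : V :=
  match c with
  | PT => dψ
  | CT => dψ + t • dφ
  | OT => dψ + t • dφ

/-- The 1-form `σ_η` at a point where the first coordinate is `ξ = s`. -/
def sigEta {V : Type*} [AddCommGroup V] [Module ℝ V] (c : SepClass) (s : ℝ) (dψ dφ : V) : V :=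
  match c with
  | PT => dφ
  | CT => s • dφ
  | OT => dψ + s • dφ

end SepClass

namespace ToricKahlerSurface

variable {M : Type*} [TopologicalSpace M] [ChartedSpace E4 M] [IsManifold I4 ∞ M]
variable (T : ToricKahlerSurface M)

/-- The Kähler form `J`. -/
def form (p : M) (v w : TangentSpace I4 p) : ℝ := T.metric.inner p (T.cplx p v) w

/-- The axis: the set where the Gram determinant `det h(m_i, m_j)` vanishes. -/
def axis : Set M :=
  {p | (Matrix.of fun i j : Fin 2 => T.metric.inner p (T.m i p) (T.m j p)).det = 0}

/-- `fξ, fη` are the partial derivatives on `U` of the torus-invariant function `f` with respect to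
`ξ, η`, that is, `df = fξ dξ + fη dη`. -/
def HasPartials (U : Set M) (ξ η f fξ fη : M → ℝ) : Prop :=
  ∀ p ∈ U, dif f p = fξ p • dif ξ p + fη p • dif η p

/-- `(ξ, η)` is an orthogonal coordinate system on `U`: smooth torus-invariant functions with
nowhere vanishing and orthogonal differentials (the metric dual `v` of `dξ` satisfies `dη(v) = 0`).
-/
structure IsOrthogonalCoords (U : Set M) (ξ η : M → ℝ) : Prop where
  smooth_xi : ContMDiffOn I4 𝓘(ℝ, ℝ) ∞ ξ U
  smooth_eta : ContMDiffOn I4 𝓘(ℝ, ℝ) ∞ η U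
  invariant_xi : ∀ p ∈ U, ∀ i : Fin 2, dif ξ p (T.m i p) = 0
  invariant_eta : ∀ p ∈ U, ∀ i : Fin 2, dif η p (T.m i p) = 0
  dxi_ne_zero : ∀ p ∈ U, dif ξ p ≠ 0
  deta_ne_zero : ∀ p ∈ U, dif η p ≠ 0
  orthogonal : ∀ p ∈ U, ∃ v : TangentSpace I4 p,
    (∀ w : TangentSpace I4 p, T.metric.inner p v w = dif ξ p w) ∧ dif η p v = 0

/-- The toric Kähler surface is separable on `U` with respect to `(ξ, η)`: these are orthogonal
coordinates and `∂_ξ² x_i = 0 = ∂_η² x_i` for the moment maps. Here `u = ∂_ξ x_i`, `v = ∂_η x_i`. -/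
structure IsSeparable (U : Set M) (ξ η : M → ℝ) : Prop extends T.IsOrthogonalCoords U ξ η where
  separable : ∀ i : Fin 2, ∃ u v : M → ℝ,
    ContMDiffOn I4 𝓘(ℝ, ℝ) ∞ u U ∧ ContMDiffOn I4 𝓘(ℝ, ℝ) ∞ v U ∧
    HasPartials U ξ η (T.x i) u v ∧
    (∃ u' : M → ℝ, HasPartials U ξ η u 0 u') ∧
    (∃ v' : M → ℝ, HasPartials U ξ η v v' 0)

/-- `Ω` is the Jacobian `⟨∂_ξ x, ∂_η x⟩ = ∂_ξ x₁ ∂_η x₂ - ∂_ξ x₂ ∂_η x₁` on `U`. -/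
def IsJacobian (U : Set M) (ξ η Ω : M → ℝ) : Prop :=
  ∃ u v : Fin 2 → M → ℝ, (∀ i, HasPartials U ξ η (T.x i) (u i) (v i)) ∧
    ∀ p ∈ U, Ω p = u 0 p * v 1 p - u 1 p * v 0 p

/-- The class of a separable structure relative to the coordinates `(ξ, η)`: both, exactly one or
none of `∂_ξ Ω` and `∂_η Ω` vanish. -/
def IsOfClass (U : Set M) (ξ η : M → ℝ) (c : SepClass) : Prop :=
  ∃ Ω Ωξ Ωη : M → ℝ, ContMDiffOn I4 𝓘(ℝ, ℝ) ∞ Ω U ∧ T.IsJacobian U ξ η Ω ∧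
    HasPartials U ξ η Ω Ωξ Ωη ∧
    match c with
    | SepClass.PT => ∀ p ∈ U, Ωξ p = 0 ∧ Ωη p = 0
    | SepClass.CT => (∀ p ∈ U, Ωξ p ≠ 0 ∧ Ωη p = 0) ∨ (∀ p ∈ U, Ωξ p = 0 ∧ Ωη p ≠ 0)
    | SepClass.OT => ∀ p ∈ U, Ωξ p ≠ 0 ∧ Ωη p ≠ 0

/-- `(ξ', η')` arises from `(ξ, η)` by an affine change of each coordinate and possibly an exchange
of the two. -/
def IsAffineChange (ξ η ξ' η' : M → ℝ) : Prop :=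
  ∃ K₁ C₁ K₂ C₂ : ℝ, K₁ ≠ 0 ∧ K₂ ≠ 0 ∧
    ((∀ p, ξ' p = K₁ * ξ p + C₁ ∧ η' p = K₂ * η p + C₂) ∨
     (∀ p, ξ' p = K₁ * η p + C₁ ∧ η' p = K₂ * ξ p + C₂))

/-- The normal form of class `c` at a point `p`, in coordinates `(ξ, η, ψ, φ) = e`. -/
structure NormalFormAt (c : SepClass) (A : Matrix (Fin 2) (Fin 2) ℝ) (F G : ℝ → ℝ)
    (ξ η ψ φ : M → ℝ) (p : M) : Prop where
  smooth_F : ContDiffAt ℝ ∞ F (ξ p)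
  smooth_G : ContDiffAt ℝ ∞ G (η p)
  Sig_ne_zero : c.Sig (ξ p) (η p) ≠ 0
  F_ne_zero : F (ξ p) ≠ 0
  G_ne_zero : G (η p) ≠ 0
  /-- `h = Σ (dξ² / F + dη² / G) + Σ⁻¹ (F σ_ξ² + G σ_η²)`, as a symmetric bilinear form -/
  metric_eq : ∀ v w : TangentSpace I4 p,
    T.metric.inner p v w =
      c.Sig (ξ p) (η p) *
          (dif ξ p v * dif ξ p w / F (ξ p) + dif η p v * dif η p w / G (η p))
        + 1 / c.Sig (ξ p) (η p) *
          (F (ξ p) * (c.sigXi (η p) (dif ψ p) (dif φ p) v * c.sigXi (η p) (dif ψ p) (dif φ p) w)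
            + G (η p) *
              (c.sigEta (ξ p) (dif ψ p) (dif φ p) v * c.sigEta (ξ p) (dif ψ p) (dif φ p) w))
  /-- `J = d (P dψ + Q dφ) = dP ∧ dψ + dQ ∧ dφ` -/
  form_eq : ∀ v w : TangentSpace I4 p,
    T.form p v w =
      wedge (dif (fun q => c.P (ξ q) (η q)) p) (dif ψ p) v w
        + wedge (dif (fun q => c.Q (ξ q) (η q)) p) (dif φ p) v w
  /-- `m_i = A₁ᵢ ∂_ψ + A₂ᵢ ∂_φ` -/
  killing_xi : ∀ i, dif ξ p (T.m i p) = 0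
  killing_eta : ∀ i, dif η p (T.m i p) = 0
  killing_psi : ∀ i, dif ψ p (T.m i p) = A 0 i
  killing_phi : ∀ i, dif φ p (T.m i p) = A 1 i

/-- On `U` the structure has the normal form of class `c`, in coordinates `(ξ', η')` obtained from
`(ξ, η)` by affine changes and possibly an exchange: around each point of `U` the functions `ξ', η'`
are completed by angular functions `ψ, φ` to a chart `e = (ξ', η', ψ, φ)` of the smooth manifold
in which metric and Kähler form are as in `NormalFormAt`. The invertible matrix `A` that relates
`m₁, m₂` to `∂_ψ, ∂_φ` is constant on `U`, `x_i = k_i + A₁ᵢ P + A₂ᵢ Q`, and the Jacobian of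
`(ξ', η') ↦ (x₁, x₂)` is `N Σ` with a nonzero constant `N`. -/
def HasNormalForm (U : Set M) (ξ η : M → ℝ) (c : SepClass) : Prop :=
  ∃ (ξ' η' : M → ℝ) (A : Matrix (Fin 2) (Fin 2) ℝ) (k : Fin 2 → ℝ),
    IsAffineChange ξ η ξ' η' ∧ A.det ≠ 0 ∧
    (∀ p ∈ U, ∀ i, T.x i p = k i + A 0 i * c.P (ξ' p) (η' p) + A 1 i * c.Q (ξ' p) (η' p)) ∧
    (∃ N : ℝ, N ≠ 0 ∧ T.IsJacobian U ξ' η' (fun p => N * c.Sig (ξ' p) (η' p))) ∧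
    ∀ p ∈ U, ∃ e ∈ IsManifold.maximalAtlas I4 ∞ M, p ∈ e.source ∧ e.source ⊆ U ∧
      (∀ q ∈ e.source, e q 0 = ξ' q ∧ e q 1 = η' q) ∧
      ∃ F G : ℝ → ℝ, ∀ q ∈ e.source,
        T.NormalFormAt c A F G ξ' η' (fun q => e q 2) (fun q => e q 3) q

end ToricKahlerSurface

end

/-! Along orthogonal coordinates the condition `∂_ξ² x_i = ∂_η² x_i = 0` together with `d² = 0`
forces the mixed derivative to be constant, so on the connected set `U` one has `x_i = k_i + a_i ξ +
b_i η + w_i ξη` (`exists_bilinear_of_partials`). Hence `Ω = Z + Xξ + Yη` with constants `X = a × w`,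
`Y = w × b`, `Z = a × b`, where `×` is the determinant of two vectors of the plane. Its partial
derivatives are the constants `X` and `Y`, and the trichotomy is the case distinction on which of
them vanish (`isOfClass_iff`). Off the axis `Ω` has no zero, because the Gram determinant of `m₁,
m₂` is a multiple of it. The identity `Z w = X b + Y a` then gives `w = 0` for PT, while Cramer's
rule gives `b = l w` for CT and `b = l w + r a` with `r ≠ 0` for OT. A shift of `ξ` by `l` and a
scaling of `η` by `r` bring `x_i` to the form `k_i + A₁ᵢ P + A₂ᵢ Q`.

From there on the three classes are treated together, by writing `dP = dξ + β₀ dη` and `dQ = α(η) dξ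
+ β₁(ξ) dη`, so that `Σ = β₁ - α β₀`, `σ_ξ = dψ + α dφ` and `σ_η = β₀ dψ + β₁ dφ`. The combinations
`n₀, n₁` of `m₁, m₂` with coefficients from `A⁻¹` have Hamiltonians `P, Q` up to constants.
Pointwise linear algebra (`IsHamiltonianFrame`) expresses metric and Kähler form by `Σ`, `F =
Σ|dξ|²` and `G = Σ|dη|²`.

The fields `m₁, m₂, I m₁, I m₂` commute, by holomorphy and integrability, and are independent off
the axis. So they are locally coordinate fields, and this yields both the angles `ψ, φ` and
functions `y₀, y₁` whose differentials are dual to `I n₀, I n₁`. One finds `dy₀ = -(β₁/F) dξ + (α/G)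
dη` and `dy₁ = (β₀/F) dξ - (1/G) dη`. Since `d² y_k = 0` and `Σ ≠ 0`, it follows that `d(1/F) ∧ dξ =
0` and `d(1/G) ∧ dη = 0` (`HasMomentDif.dif_inv_profile`), so in a chart with convex target `F` is a
function of `ξ` and `G` of `η`. -/

open scoped Topology

noncomputable section

set_option linter.unusedSectionVars false

/-! ### Differentials in charts, and `d² = 0` -/

section Charts

variable {M : Type*} [TopologicalSpace M] [ChartedSpace E4 M] [IsManifold I4 ∞ M]

theorem contDiffAt_comp_chart_symm {e : OpenPartialHomeomorph M E4}
    (he : e ∈ IsManifold.maximalAtlas I4 ∞ M) {f : M → ℝ} {y : E4} (hy : y ∈ e.target)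
    (hf : ContMDiffAt I4 𝓘(ℝ, ℝ) ∞ f (e.symm y)) : ContDiffAt ℝ ∞ (f ∘ e.symm) y :=
  (hf.comp y (contMDiffAt_symm_of_mem_maximalAtlas he hy)).contDiffAt

theorem contMDiffAt_comp_chart {e : OpenPartialHomeomorph M E4}
    (he : e ∈ IsManifold.maximalAtlas I4 ∞ M) {f : E4 → ℝ} {q : M} (hq : q ∈ e.source)
    (hf : ContDiffAt ℝ ∞ f (e q)) : ContMDiffAt I4 𝓘(ℝ, ℝ) ∞ (f ∘ e) q :=
  hf.contMDiffAt.comp q (contMDiffAt_of_mem_maximalAtlas he hq)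

theorem fderiv_comp_chart_symm {e : OpenPartialHomeomorph M E4}
    (he : e ∈ IsManifold.maximalAtlas I4 ∞ M) {f : M → ℝ} {y : E4} (hy : y ∈ e.target)
    (hf : ContMDiffAt I4 𝓘(ℝ, ℝ) ∞ f (e.symm y)) (v : E4) :
    fderiv ℝ (f ∘ e.symm) y v = dif f (e.symm y) (mfderiv I4 I4 e.symm y v) := by
  have h := mfderiv_comp (I := I4) (I' := I4) (I'' := 𝓘(ℝ, ℝ)) y (g := f) (f := e.symm)
    (hf.mdifferentiableAt (by simp))
    ((contMDiffAt_symm_of_mem_maximalAtlas he hy).mdifferentiableAt (by simp))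
  rw [mfderiv_eq_fderiv] at h
  rw [h]; rfl

theorem dif_comp_chart {e : OpenPartialHomeomorph M E4}
    (he : e ∈ IsManifold.maximalAtlas I4 ∞ M) {f : E4 → ℝ} {q : M} (hq : q ∈ e.source)
    (hf : ContDiffAt ℝ ∞ f (e q)) (v : TangentSpace I4 q) :
    dif (f ∘ e) q v = fderiv ℝ f (e q) (mfderiv I4 I4 e q v) := by
  have h := mfderiv_comp (I := I4) (I' := I4) (I'' := 𝓘(ℝ, ℝ)) q (g := f) (f := e)
    (hf.contMDiffAt.mdifferentiableAt (by simp))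
    ((contMDiffAt_of_mem_maximalAtlas he hq).mdifferentiableAt (by simp))
  rw [mfderiv_eq_fderiv] at h
  rw [dif, h]; rfl

theorem dif_congr {f g : M → ℝ} {p : M} (h : f =ᶠ[𝓝 p] g) : dif f p = dif g p :=
  h.mfderiv_eq

theorem dif_eq_fderiv_chart {e : OpenPartialHomeomorph M E4}
    (he : e ∈ IsManifold.maximalAtlas I4 ∞ M) {f : M → ℝ} {q : M} (hq : q ∈ e.source)
    (hf : ContMDiffAt I4 𝓘(ℝ, ℝ) ∞ f q) (v : TangentSpace I4 q) :
    dif f q v = fderiv ℝ (f ∘ e.symm) (e q) (mfderiv I4 I4 e q v) := by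
  have hf' : ContMDiffAt I4 𝓘(ℝ, ℝ) ∞ f (e.symm (e q)) := by rwa [e.left_inv hq]
  rw [← dif_comp_chart he hq (contDiffAt_comp_chart_symm he (e.map_source hq) hf')]
  rw [dif_congr (f := f) (g := (f ∘ e.symm) ∘ e)]
  filter_upwards [e.open_source.mem_nhds hq] with x hx
  simp [e.left_inv hx]

theorem mfderiv_symm_mfderiv_chart {e : OpenPartialHomeomorph M E4}
    (he : e ∈ IsManifold.maximalAtlas I4 ∞ M) {y : E4} (hy : y ∈ e.target) (v : E4) :
    mfderiv I4 I4 e (e.symm y) (mfderiv I4 I4 e.symm y v) = v := by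
  have h := mfderiv_comp (I := I4) (I' := I4) (I'' := I4) y (g := e) (f := e.symm)
    ((contMDiffAt_of_mem_maximalAtlas he (e.map_target hy)).mdifferentiableAt (by simp))
    ((contMDiffAt_symm_of_mem_maximalAtlas he hy).mdifferentiableAt (by simp))
  have h2 : (e ∘ e.symm) =ᶠ[𝓝 y] id := by
    filter_upwards [e.open_target.mem_nhds hy] with x hx
    simp [e.right_inv hx]
  rw [h2.mfderiv_eq, mfderiv_id] at h
  exact (DFunLike.congr_fun h v).symm

theorem mfderiv_mfderiv_symm_chart {e : OpenPartialHomeomorph M E4}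
    (he : e ∈ IsManifold.maximalAtlas I4 ∞ M) {y : E4} (hy : y ∈ e.target)
    (v : TangentSpace I4 (e.symm y)) :
    mfderiv I4 I4 e.symm y (mfderiv I4 I4 e (e.symm y) v) = v := by
  have hs : e.symm y ∈ e.source := e.map_target hy
  have h := mfderiv_comp (I := I4) (I' := I4) (I'' := I4) (e.symm y) (g := e.symm) (f := e)
    (by rw [e.right_inv hy]
        exact (contMDiffAt_symm_of_mem_maximalAtlas he hy).mdifferentiableAt (by simp))
    ((contMDiffAt_of_mem_maximalAtlas he hs).mdifferentiableAt (by simp))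
  have h2 : (e.symm ∘ e) =ᶠ[𝓝 (e.symm y)] id := by
    filter_upwards [e.open_source.mem_nhds hs] with x hx
    simp [e.left_inv hx]
  rw [h2.mfderiv_eq, mfderiv_id, e.right_inv hy] at h
  exact (DFunLike.congr_fun h v).symm

theorem isInvertible_mfderiv_chart_symm {e : OpenPartialHomeomorph M E4}
    (he : e ∈ IsManifold.maximalAtlas I4 ∞ M) {y : E4} (hy : y ∈ e.target) :
    (mfderiv I4 I4 e.symm y).IsInvertible :=
  ⟨ContinuousLinearEquiv.equivOfInverse _ (mfderiv I4 I4 e (e.symm y))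
    (mfderiv_symm_mfderiv_chart he hy) (mfderiv_mfderiv_symm_chart he hy), rfl⟩

theorem eventually_comp_chart_symm (e : OpenPartialHomeomorph M E4) {y : E4}
    (hy : y ∈ e.target) {P : M → Prop} (h : ∀ᶠ q in 𝓝 (e.symm y), P q) :
    ∀ᶠ z in 𝓝 y, P (e.symm z) :=
  (e.continuousAt_symm hy).eventually h

/-- The exterior derivative of `df = u dξ + v dη` vanishes. -/
theorem wedge_add_wedge_eq_zero {f u v ξ η : M → ℝ} {p : M}
    (hf : ∀ᶠ q in 𝓝 p, ContMDiffAt I4 𝓘(ℝ, ℝ) ∞ f q)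
    (hu : ContMDiffAt I4 𝓘(ℝ, ℝ) ∞ u p) (hv : ContMDiffAt I4 𝓘(ℝ, ℝ) ∞ v p)
    (hξ : ∀ᶠ q in 𝓝 p, ContMDiffAt I4 𝓘(ℝ, ℝ) ∞ ξ q)
    (hη : ∀ᶠ q in 𝓝 p, ContMDiffAt I4 𝓘(ℝ, ℝ) ∞ η q)
    (h : ∀ᶠ q in 𝓝 p, dif f q = u q • dif ξ q + v q • dif η q) (a b : TangentSpace I4 p) :
    wedge (dif u p) (dif ξ p) a b + wedge (dif v p) (dif η p) a b = 0 := by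
  set e := chartAt E4 p with he_def
  have he : e ∈ IsManifold.maximalAtlas I4 ∞ M := IsManifold.chart_mem_maximalAtlas p
  have hp : p ∈ e.source := mem_chart_source E4 p
  have hy : e p ∈ e.target := e.map_source hp
  have hl : e.symm (e p) = p := e.left_inv hp
  have key : fderiv ℝ (f ∘ e.symm) =ᶠ[𝓝 (e p)] fun y => (u ∘ e.symm) y • fderiv ℝ (ξ ∘ e.symm) y
      + (v ∘ e.symm) y • fderiv ℝ (η ∘ e.symm) y := by
    rw [← hl] at hf hξ hη h
    filter_upwards [eventually_comp_chart_symm e hy hf, eventually_comp_chart_symm e hy hξ,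
      eventually_comp_chart_symm e hy hη, eventually_comp_chart_symm e hy h,
      e.open_target.mem_nhds hy] with y h1 h2 h3 h4 h5
    ext w
    simp only [add_apply, smul_apply,
      fderiv_comp_chart_symm he h5 h1, fderiv_comp_chart_symm he h5 h2,
      fderiv_comp_chart_symm he h5 h3, h4, Function.comp]
  have cf : ContDiffAt ℝ ∞ (f ∘ e.symm) (e p) :=
    contDiffAt_comp_chart_symm he hy (by rw [hl]; exact hf.self_of_nhds)
  have cu : ContDiffAt ℝ ∞ (u ∘ e.symm) (e p) :=
    contDiffAt_comp_chart_symm he hy (by rw [hl]; exact hu)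
  have cv : ContDiffAt ℝ ∞ (v ∘ e.symm) (e p) :=
    contDiffAt_comp_chart_symm he hy (by rw [hl]; exact hv)
  have cξ : ContDiffAt ℝ ∞ (ξ ∘ e.symm) (e p) :=
    contDiffAt_comp_chart_symm he hy (by rw [hl]; exact hξ.self_of_nhds)
  have cη : ContDiffAt ℝ ∞ (η ∘ e.symm) (e p) :=
    contDiffAt_comp_chart_symm he hy (by rw [hl]; exact hη.self_of_nhds)
  have dd : ∀ {g : E4 → ℝ}, ContDiffAt ℝ ∞ g (e p) → DifferentiableAt ℝ (fderiv ℝ g) (e p) :=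
    fun hg => (hg.fderiv_right (m := 1) (by norm_cast)).differentiableAt (by simp)
  have d1 : ∀ {g : E4 → ℝ}, ContDiffAt ℝ ∞ g (e p) → DifferentiableAt ℝ g (e p) :=
    fun hg => hg.differentiableAt (by simp)
  have sy : ∀ {g : E4 → ℝ}, ContDiffAt ℝ ∞ g (e p) → ∀ a b,
      fderiv ℝ (fderiv ℝ g) (e p) a b = fderiv ℝ (fderiv ℝ g) (e p) b a :=
    fun hg a b => (hg.isSymmSndFDerivAt (by rw [minSmoothness_of_isRCLikeNormedField, ← one_add_one_eq_two]; norm_cast)) a b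
  -- Differentiating `df = u dξ + v dη` once more and antisymmetrizing removes the Hessians of `f`,
  -- `ξ` and `η`; only `du ∧ dξ + dv ∧ dη` remains.
  have k2 := ((((d1 cu).hasFDerivAt.smul (dd cξ).hasFDerivAt).add
    ((d1 cv).hasFDerivAt.smul (dd cη).hasFDerivAt)).congr_of_eventuallyEq key).fderiv
  have k3 : ∀ a b : E4, fderiv ℝ (u ∘ e.symm) (e p) a * fderiv ℝ (ξ ∘ e.symm) (e p) b
      - fderiv ℝ (u ∘ e.symm) (e p) b * fderiv ℝ (ξ ∘ e.symm) (e p) a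
      + (fderiv ℝ (v ∘ e.symm) (e p) a * fderiv ℝ (η ∘ e.symm) (e p) b
      - fderiv ℝ (v ∘ e.symm) (e p) b * fderiv ℝ (η ∘ e.symm) (e p) a) = 0 := by
    intro a b
    have e1 := DFunLike.congr_fun (DFunLike.congr_fun k2 a) b
    have e2 := DFunLike.congr_fun (DFunLike.congr_fun k2 b) a
    simp only [add_apply, smul_apply,
      ContinuousLinearMap.smulRight_apply, smul_eq_mul] at e1 e2
    rw [sy cf a b, e2, sy cξ b a, sy cη b a] at e1
    linarith
  simp only [wedge]
  rw [dif_eq_fderiv_chart he hp hu, dif_eq_fderiv_chart he hp hu,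
    dif_eq_fderiv_chart he hp hv, dif_eq_fderiv_chart he hp hv,
    dif_eq_fderiv_chart he hp hξ.self_of_nhds, dif_eq_fderiv_chart he hp hξ.self_of_nhds,
    dif_eq_fderiv_chart he hp hη.self_of_nhds, dif_eq_fderiv_chart he hp hη.self_of_nhds]
  exact k3 _ _

end Charts

/-! ### Commuting frames on open subsets of `ℝ⁴` -/

section Potentials

/-- The linear map that sends the standard basis to the frame `X`. -/
def frameMap (X : Fin 4 → E4 → E4) (y : E4) : E4 →L[ℝ] E4 :=
  ∑ l, (EuclideanSpace.proj l : E4 →L[ℝ] ℝ).smulRight (X l y)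

theorem frameMap_apply (X : Fin 4 → E4 → E4) (y c : E4) :
    frameMap X y c = ∑ l, c l • X l y := by
  simp [frameMap, sum_apply]

theorem frameMap_isInvertible {X : Fin 4 → E4 → E4} {y : E4}
    (h : LinearIndependent ℝ fun l => X l y) : (frameMap X y).IsInvertible := by
  have hinj : Function.Injective (frameMap X y : E4 →ₗ[ℝ] E4) := by
    rw [injective_iff_map_eq_zero]
    intro c hc
    have hc' : ∑ l, c l • X l y = 0 := by rw [← frameMap_apply]; exact hc
    have := Fintype.linearIndependent_iff.1 h (fun l => c l) hc'
    ext l; simpa using this l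
  refine ⟨(LinearEquiv.ofInjectiveEndo _ hinj).toContinuousLinearEquiv, ?_⟩
  ext c; rfl

/-- The dual coframe `θ k` is closed: its values on the frame are constant, so `dθ k (X i, X j) = -θ
k [X i, X j] = 0`. The Poincaré lemma on a ball around `y₀` supplies the functions `t k`. -/
theorem exists_potentials_of_commuting_frame {X : Fin 4 → E4 → E4} {W : Set E4} (hW : IsOpen W)
    {y₀ : E4} (hy₀ : y₀ ∈ W) (hX : ∀ l, ∀ y ∈ W, ContDiffAt ℝ ∞ (X l) y)
    (hbr : ∀ k l, ∀ y ∈ W, VectorField.lieBracket ℝ (X k) (X l) y = 0)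
    (hli : ∀ y ∈ W, LinearIndependent ℝ fun l => X l y) :
    ∃ V ⊆ W, IsOpen V ∧ y₀ ∈ V ∧ ∃ t : Fin 4 → E4 → ℝ, ∀ k, ∀ y ∈ V, ContDiffAt ℝ ∞ (t k) y ∧
      ∀ l, fderiv ℝ (t k) y (X l y) = if l = k then 1 else 0 := by
  obtain ⟨r, hr, hrW⟩ := Metric.isOpen_iff.1 hW y₀ hy₀
  set θ : Fin 4 → E4 → (E4 →L[ℝ] ℝ) := fun k y =>
    (EuclideanSpace.proj k : E4 →L[ℝ] ℝ).comp (frameMap X y).inverse with hθ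
  have hθs : ∀ k, ∀ y ∈ W, ContDiffAt ℝ ∞ (θ k) y := by
    intro k y hy
    have h1 : ContDiffAt ℝ ∞ (frameMap X) y := by
      unfold frameMap
      refine ContDiffAt.sum fun l _ => ?_
      exact contDiffAt_const.smulRight (hX l y hy)
    obtain ⟨e, he⟩ := frameMap_isInvertible (hli y hy)
    have h2 : ContDiffAt ℝ ∞ (fun z => (frameMap X z).inverse) y := by
      refine ContDiffAt.comp y (g := ContinuousLinearMap.inverse) ?_ h1
      rw [← he]
      exact contDiffAt_map_inverse e
    exact contDiffAt_const.clm_comp h2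
  have hθX : ∀ k l, ∀ y ∈ W, θ k y (X l y) = if l = k then 1 else 0 := by
    intro k l y hy
    have h1 : X l y = frameMap X y (EuclideanSpace.single l 1) := by
      rw [frameMap_apply]; simp
    simp only [hθ, ContinuousLinearMap.comp_apply]
    rw [h1, (frameMap_isInvertible (hli y hy)).inverse_apply_self]
    simp [eq_comm]
  have hclosed : ∀ k, ∀ y ∈ W, ∀ v w, fderiv ℝ (θ k) y v w = fderiv ℝ (θ k) y w v := by
    intro k y hy
    have hd : ∀ l v, fderiv ℝ (θ k) y v (X l y) = - θ k y (fderiv ℝ (X l) y v) := by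
      intro l v
      have h1 := (((hθs k y hy).differentiableAt (by simp)).hasFDerivAt.clm_apply
        ((hX l y hy).differentiableAt (by simp)).hasFDerivAt)
      have h2 : (fun z => θ k z (X l z)) =ᶠ[𝓝 y] fun _ => if l = k then (1 : ℝ) else 0 := by
        filter_upwards [hW.mem_nhds hy] with z hz using hθX k l z hz
      have h3 := (h1.congr_of_eventuallyEq h2.symm).unique (hasFDerivAt_const _ y)
      have h4 := DFunLike.congr_fun h3 v
      simp at h4
      linarith
    have hs : ∀ j l, fderiv ℝ (θ k) y (X j y) (X l y) = fderiv ℝ (θ k) y (X l y) (X j y) := by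
      intro j l
      have := hbr j l y hy
      rw [VectorField.lieBracket, sub_eq_zero] at this
      rw [hd, hd, this]
    intro v w
    obtain ⟨e, he⟩ := frameMap_isInvertible (hli y hy)
    have hsurj : ∀ v : E4, ∃ c : E4, v = ∑ l, c l • X l y := fun v =>
      ⟨e.symm v, by rw [← frameMap_apply X y (e.symm v), ← he]; simp⟩
    obtain ⟨a, rfl⟩ := hsurj v
    obtain ⟨b, rfl⟩ := hsurj w
    simp only [map_sum, map_smul, sum_apply, smul_apply, Finset.smul_sum]
    rw [Finset.sum_comm]
    refine Finset.sum_congr rfl fun i _ => Finset.sum_congr rfl fun j _ => ?_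
    rw [hs, smul_comm]
  have hpot : ∀ k, ∃ t : E4 → ℝ, ∀ y ∈ Metric.ball y₀ r, HasFDerivAt t (θ k y) y := fun k =>
    (convex_ball y₀ r).exists_forall_hasFDerivAt_of_fderiv_symmetric Metric.isOpen_ball
      (fun y hy => ((hθs k y (hrW hy)).differentiableAt (by simp)).differentiableWithinAt)
      (fun y hy => hclosed k y (hrW hy))
  choose t ht using hpot
  refine ⟨Metric.ball y₀ r, hrW, Metric.isOpen_ball, Metric.mem_ball_self hr, t, fun k y hy => ?_⟩
  have hfd : ∀ z ∈ Metric.ball y₀ r, fderiv ℝ (t k) z = θ k z := fun z hz => (ht k z hz).fderiv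
  constructor
  · have : ContDiffOn ℝ ∞ (t k) (Metric.ball y₀ r) := by
      rw [contDiffOn_infty_iff_fderiv_of_isOpen Metric.isOpen_ball]
      refine ⟨fun z hz => (ht k z hz).differentiableAt.differentiableWithinAt, ?_⟩
      refine ContDiffOn.congr (f := θ k) (fun z hz => (hθs k z (hrW hz)).contDiffWithinAt) hfd
    exact this.contDiffAt (Metric.isOpen_ball.mem_nhds hy)
  · intro l
    rw [hfd y hy]
    exact hθX k l y (hrW hy)

end Potentials

/-! ### Vector fields in charts -/

section Fields

variable {M : Type*} [TopologicalSpace M] [ChartedSpace E4 M] [IsManifold I4 ∞ M]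

theorem two_le_minSmoothness : minSmoothness ℝ 2 ≤ (∞ : WithTop ℕ∞) := by
  rw [minSmoothness_of_isRCLikeNormedField, ← one_add_one_eq_two]; norm_cast

/-- The expression of a vector field in a chart. -/
def fieldInChart (e : OpenPartialHomeomorph M E4) (X : (q : M) → TangentSpace I4 q) : E4 → E4 :=
  VectorField.mpullback I4 I4 e.symm X

theorem mfderiv_symm_fieldInChart {e : OpenPartialHomeomorph M E4}
    (he : e ∈ IsManifold.maximalAtlas I4 ∞ M) {y : E4} (hy : y ∈ e.target)
    (X : (q : M) → TangentSpace I4 q) :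
    mfderiv I4 I4 e.symm y (fieldInChart e X y) = X (e.symm y) :=
  (isInvertible_mfderiv_chart_symm he hy).self_apply_inverse _

theorem contDiffAt_fieldInChart {e : OpenPartialHomeomorph M E4}
    (he : e ∈ IsManifold.maximalAtlas I4 ∞ M) {y : E4} (hy : y ∈ e.target)
    {X : (q : M) → TangentSpace I4 q} (hX : SmoothFieldAt X (e.symm y)) :
    ContDiffAt ℝ ∞ (fieldInChart e X) y := by
  have h := ContMDiffAt.mpullback_vectorField_preimage (m := ∞) (n := ∞) (f := e.symm) (x₀ := y) hX
    (contMDiffAt_symm_of_mem_maximalAtlas he hy)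
    (isInvertible_mfderiv_chart_symm he hy) (by norm_cast)
  exact contMDiffAt_vectorSpace_iff_contDiffAt.1 h

theorem lieBracket_fieldInChart_eq_zero {e : OpenPartialHomeomorph M E4}
    (he : e ∈ IsManifold.maximalAtlas I4 ∞ M) {y : E4} (hy : y ∈ e.target)
    {X Y : (q : M) → TangentSpace I4 q} (hX : SmoothFieldAt X (e.symm y))
    (hY : SmoothFieldAt Y (e.symm y)) (h : VectorField.mlieBracket I4 X Y (e.symm y) = 0) :
    VectorField.lieBracket ℝ (fieldInChart e X)
      (fieldInChart e Y) y = 0 := by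
  have : IsManifold I4 (minSmoothness ℝ 2) M := IsManifold.of_le two_le_minSmoothness
  have h1 := VectorField.mpullback_mlieBracket (n := ∞) (f := e.symm) (x₀ := y)
    (hX.mdifferentiableAt (by simp)) (hY.mdifferentiableAt (by simp))
    (contMDiffAt_symm_of_mem_maximalAtlas he hy) two_le_minSmoothness
  rw [VectorField.mpullback_apply, h, map_zero, ← VectorField.mlieBracketWithin_univ,
    VectorField.mlieBracketWithin_eq_lieBracketWithin] at h1
  rw [← VectorField.lieBracketWithin_univ]
  exact h1.symm

theorem dif_apply_field_chart {e : OpenPartialHomeomorph M E4}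
    (he : e ∈ IsManifold.maximalAtlas I4 ∞ M) {f : M → ℝ} {y : E4} (hy : y ∈ e.target)
    (hf : ContMDiffAt I4 𝓘(ℝ, ℝ) ∞ f (e.symm y)) (X : (q : M) → TangentSpace I4 q) :
    dif f (e.symm y) (X (e.symm y)) =
      fderiv ℝ (f ∘ e.symm) y (fieldInChart e X y) := by
  rw [fderiv_comp_chart_symm he hy hf, mfderiv_symm_fieldInChart he hy]

/-- The derivative of a smooth function along a smooth vector field is smooth. -/
theorem contMDiffAt_dif_apply {f : M → ℝ} {X : (q : M) → TangentSpace I4 q} {p : M}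
    (hf : ∀ᶠ q in 𝓝 p, ContMDiffAt I4 𝓘(ℝ, ℝ) ∞ f q) (hX : SmoothFieldAt X p) :
    ContMDiffAt I4 𝓘(ℝ, ℝ) ∞ (fun q => dif f q (X q)) p := by
  set e := chartAt E4 p with he_def
  have he : e ∈ IsManifold.maximalAtlas I4 ∞ M := IsManifold.chart_mem_maximalAtlas p
  have hp : p ∈ e.source := mem_chart_source E4 p
  have hy : e p ∈ e.target := e.map_source hp
  have hl : e.symm (e p) = p := e.left_inv hp
  have h1 : ContDiffAt ℝ ∞ (fun y => fderiv ℝ (f ∘ e.symm) y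
      (fieldInChart e X y)) (e p) := by
    refine ContDiffAt.clm_apply ?_ (contDiffAt_fieldInChart he hy (by rwa [hl]))
    exact (contDiffAt_comp_chart_symm he hy (by rw [hl]; exact hf.self_of_nhds)).fderiv_right
      (by norm_cast)
  refine (contMDiffAt_comp_chart he hp h1).congr_of_eventuallyEq ?_
  filter_upwards [e.open_source.mem_nhds hp, hf] with q hq hfq
  have := dif_apply_field_chart he (e.map_source hq) (f := f) (by rwa [e.left_inv hq]) X
  rw [e.left_inv hq] at this
  exact this

/-- A commuting frame is locally the frame of coordinate fields of smooth functions `t k`. -/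
theorem exists_coordinates_of_commuting_frame {X : Fin 4 → (q : M) → TangentSpace I4 q}
    {U : Set M} (hU : IsOpen U) {p : M} (hp : p ∈ U) (hX : ∀ l, ∀ q ∈ U, SmoothFieldAt (X l) q)
    (hbr : ∀ k l, ∀ q ∈ U, VectorField.mlieBracket I4 (X k) (X l) q = 0)
    (hli : ∀ q ∈ U, LinearIndependent ℝ fun l => X l q) :
    ∃ V ⊆ U, IsOpen V ∧ p ∈ V ∧ ∃ t : Fin 4 → M → ℝ, ∀ k, ∀ q ∈ V,
      ContMDiffAt I4 𝓘(ℝ, ℝ) ∞ (t k) q ∧ ∀ l, dif (t k) q (X l q) = if l = k then 1 else 0 := by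
  set e := chartAt E4 p with he_def
  have he : e ∈ IsManifold.maximalAtlas I4 ∞ M := IsManifold.chart_mem_maximalAtlas p
  have hpe : p ∈ e.source := mem_chart_source E4 p
  have hl : e.symm (e p) = p := e.left_inv hpe
  obtain ⟨V, hVW, hVo, hyV, t, ht⟩ := exists_potentials_of_commuting_frame
    (X := fun l => fieldInChart e (X l))
    (W := e.target ∩ e.symm ⁻¹' U) (e.isOpen_inter_preimage_symm hU) (y₀ := e p)
    ⟨e.map_source hpe, by simpa [hl] using hp⟩
    (fun l y hy => contDiffAt_fieldInChart he hy.1 (hX l _ hy.2))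
    (fun k l y hy => lieBracket_fieldInChart_eq_zero he hy.1 (hX k _ hy.2) (hX l _ hy.2)
      (hbr k l _ hy.2))
    (fun y hy => by
      refine LinearIndependent.of_comp (M := E4) (R := ℝ)
        (mfderiv I4 I4 e.symm y).toLinearMap ?_
      convert! hli _ hy.2 using 1
      funext l
      exact mfderiv_symm_fieldInChart he hy.1 (X l))
  refine ⟨e.source ∩ e ⁻¹' V, ?_, e.isOpen_inter_preimage hVo, ⟨hpe, hyV⟩, fun k => t k ∘ e, ?_⟩
  · rintro q ⟨hq, hqV⟩
    have := (hVW hqV).2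
    simpa [e.left_inv hq] using this
  · rintro k q ⟨hq, hqV⟩
    refine ⟨contMDiffAt_comp_chart he hq (ht k _ hqV).1, fun l => ?_⟩
    rw [dif_comp_chart he hq (ht k _ hqV).1, ← (ht k _ hqV).2 l]
    congr 1
    have h2 := mfderiv_symm_fieldInChart he (e.map_source hq) (X l)
    have h3 := mfderiv_symm_mfderiv_chart he (e.map_source hq)
      (fieldInChart e (X l) (e q))
    rw [h2, e.left_inv hq] at h3
    exact h3

end Fields

/-! ### Locally constant functions, charts, functions of one coordinate -/

section LocalTools

variable {M : Type*} [TopologicalSpace M] [ChartedSpace E4 M] [IsManifold I4 ∞ M]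

theorem eq_of_dif_eq_zero {U : Set M} (hU : IsOpen U) (hUc : IsPreconnected U) {f : M → ℝ}
    (hf : ∀ q ∈ U, ContMDiffAt I4 𝓘(ℝ, ℝ) ∞ f q) (h : ∀ q ∈ U, dif f q = 0) {p q : M}
    (hp : p ∈ U) (hq : q ∈ U) : f p = f q := by
  refine hUc.induction₂ (fun x y => f x = f y) (fun x hx => ?_)
    (fun x y z _ _ _ h1 h2 => h1.trans h2) (fun x y _ _ h1 => h1.symm) hp hq
  set e := chartAt E4 x with he_def
  have he : e ∈ IsManifold.maximalAtlas I4 ∞ M := IsManifold.chart_mem_maximalAtlas x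
  have hxe : x ∈ e.source := mem_chart_source E4 x
  obtain ⟨r, hr, hrW⟩ := Metric.isOpen_iff.1 (e.isOpen_inter_preimage_symm hU) (e x)
    ⟨e.map_source hxe, by simpa [e.left_inv hxe] using hx⟩
  have hball : ∀ y ∈ Metric.ball (e x) r, f (e.symm y) = f x := by
    intro y hy
    have := Metric.isOpen_ball.is_const_of_fderiv_eq_zero (𝕜 := ℝ) (f := f ∘ e.symm)
      (convex_ball (e x) r).isPreconnected
      (fun z hz => ((contDiffAt_comp_chart_symm he (hrW hz).1
        (hf _ (hrW hz).2)).differentiableAt (by simp)).differentiableWithinAt)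
      (fun z hz => by
        ext v
        rw [fderiv_comp_chart_symm he (hrW hz).1 (hf _ (hrW hz).2), h _ (hrW hz).2]
        rfl) hy (Metric.mem_ball_self hr)
    simpa [e.left_inv hxe] using this
  refine nhdsWithin_le_nhds ?_
  filter_upwards [e.open_source.mem_nhds hxe,
    (e.continuousAt hxe).preimage_mem_nhds (Metric.ball_mem_nhds _ hr)] with y hy hy2
  have := hball _ hy2
  rw [e.left_inv hy] at this
  exact this.symm

/-- Four smooth functions with independent differentials form a chart, whose target may be taken to
be a ball. -/
theorem exists_chart_of_independent_dif {V : Set M} (hV : IsOpen V) {p : M} (hp : p ∈ V)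
    {f : Fin 4 → M → ℝ} (hf : ∀ k, ∀ q ∈ V, ContMDiffAt I4 𝓘(ℝ, ℝ) ∞ (f k) q)
    (hi : ∀ q ∈ V, ∀ v, (∀ k, dif (f k) q v = 0) → v = 0) :
    ∃ e ∈ IsManifold.maximalAtlas I4 ∞ M, p ∈ e.source ∧ e.source ⊆ V ∧
      (∀ q ∈ e.source, ∀ k, e q k = f k q) ∧ ∃ r > 0, e.target = Metric.ball (e p) r := by
  set c := chartAt E4 p with hc_def
  have hc : c ∈ IsManifold.maximalAtlas I4 ∞ M := IsManifold.chart_mem_maximalAtlas p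
  have hpc : p ∈ c.source := mem_chart_source E4 p
  set g : E4 → E4 := fun y => WithLp.toLp 2 fun k => f k (c.symm y) with hg
  set W := c.target ∩ c.symm ⁻¹' V
  have hgs : ∀ y ∈ W, ContDiffAt ℝ ∞ g y := by
    intro y hy
    rw [contDiffAt_euclidean]
    exact fun k => contDiffAt_comp_chart_symm hc hy.1 (hf k _ hy.2)
  have hgd : ∀ y ∈ W, ∃ L : E4 ≃L[ℝ] E4, HasFDerivAt g (L : E4 →L[ℝ] E4) y := by
    intro y hy
    have hd := ((hgs y hy).differentiableAt (by simp)).hasFDerivAt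
    have hinj : Function.Injective (fderiv ℝ g y : E4 →ₗ[ℝ] E4) := by
      rw [injective_iff_map_eq_zero]
      intro v hv
      have hv' : fderiv ℝ g y v = 0 := hv
      have h0 : mfderiv I4 I4 c.symm y v = 0 := by
        refine hi _ hy.2 _ fun k => ?_
        rw [← fderiv_comp_chart_symm hc hy.1 (hf k _ hy.2)]
        have h2 : HasFDerivAt (f k ∘ c.symm)
            ((EuclideanSpace.proj k : E4 →L[ℝ] ℝ).comp (fderiv ℝ g y)) y :=
          (EuclideanSpace.proj k : E4 →L[ℝ] ℝ).hasFDerivAt.comp y hd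
        rw [h2.fderiv, ContinuousLinearMap.comp_apply, hv', map_zero]
      have h3 := mfderiv_symm_mfderiv_chart hc hy.1 v
      rw [h0, map_zero] at h3
      exact h3.symm
    refine ⟨(LinearEquiv.ofInjectiveEndo _ hinj).toContinuousLinearEquiv, ?_⟩
    have hL : ((LinearEquiv.ofInjectiveEndo _ hinj).toContinuousLinearEquiv : E4 →L[ℝ] E4)
        = fderiv ℝ g y := by ext v; rfl
    rw [hL]
    exact hd
  have hpW : c p ∈ W := ⟨c.map_source hpc, by simpa [W, c.left_inv hpc] using hp⟩
  obtain ⟨L, hL⟩ := hgd _ hpW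
  set h := (hgs _ hpW).toOpenPartialHomeomorph g hL (by simp) with hh
  have hhg : (h : E4 → E4) = g := rfl
  have hph : c p ∈ h.source := ContDiffAt.mem_toOpenPartialHomeomorph_source _ _ _
  set e₁ := (c.trans h).restrOpen V hV with he₁
  have hs₁ : e₁.source = (c.source ∩ c ⁻¹' h.source) ∩ V := by
    simp [he₁]
  have hc₁ : ∀ q, e₁ q = g (c q) := fun q => rfl
  have hy₁ : ∀ y, e₁.symm y = c.symm (h.symm y) := fun y => rfl
  have hp₁ : p ∈ e₁.source := by rw [hs₁]; exact ⟨⟨hpc, hph⟩, hp⟩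
  obtain ⟨r, hr, hrT⟩ := Metric.isOpen_iff.1 e₁.open_target (e₁ p) (e₁.map_source hp₁)
  -- Restricting the inverse, rather than the chart, makes the target exactly a ball.
  set e := (e₁.symm.restrOpen (Metric.ball (e₁ p) r) Metric.isOpen_ball).symm with he
  have hT : e.target = Metric.ball (e₁ p) r := by
    simp only [he, OpenPartialHomeomorph.symm_target, OpenPartialHomeomorph.restrOpen_source,
      OpenPartialHomeomorph.symm_source]
    exact Set.inter_eq_right.2 hrT
  have hec : ∀ q, e q = g (c q) := fun q => rfl
  have hsub : e.source ⊆ e₁.source := fun q hq => by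
    have h1 : e q ∈ e.target := e.map_source hq
    have h2 : e.symm (e q) = q := e.left_inv hq
    have h3 : e₁.symm (e q) ∈ e₁.source := e₁.map_target (hrT (hT ▸ h1))
    have h4 : e₁.symm (e q) = q := h2
    rwa [h4] at h3
  have hpe : p ∈ e.source := by
    have h1 : e₁ p ∈ e.target := by rw [hT]; exact Metric.mem_ball_self hr
    have h2 := e.map_target h1
    have h3 : e.symm (e₁ p) = p := e₁.left_inv hp₁
    rwa [h3] at h2
  refine ⟨e, ?_, hpe, fun q hq => ?_, fun q hq k => ?_, r, hr, hT⟩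
  · rw [IsManifold.mem_maximalAtlas_iff_contMDiffOn]
    constructor
    · intro q hq
      have hq1 := hsub hq
      rw [hs₁] at hq1
      have hqW : c q ∈ W := ⟨c.map_source hq1.1.1, by simpa [W, c.left_inv hq1.1.1] using hq1.2⟩
      exact ((hgs _ hqW).contMDiffAt.comp q
        (contMDiffAt_of_mem_maximalAtlas hc hq1.1.1)).contMDiffWithinAt
    · intro y hy
      have hy1 : y ∈ e₁.target := by rw [hT] at hy; exact hrT hy
      have hy2 := e₁.map_target hy1
      have hyr : g (c (e₁.symm y)) = y := e₁.right_inv hy1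
      rw [hs₁] at hy2
      set q := e₁.symm y with hq
      have hqW : c q ∈ W := ⟨c.map_source hy2.1.1, by simpa [W, c.left_inv hy2.1.1] using hy2.2⟩
      have hyh : h.symm y = c q := by
        have : h (c q) = y := hyr
        rw [← this, h.left_inv hy2.1.2]
      have hyt : y ∈ h.target := by
        have : h (c q) = y := hyr
        rw [← this]; exact h.map_source hy2.1.2
      obtain ⟨L', hL'⟩ := hgd _ hqW
      -- The inverse is smooth at every point of the target, not only at the centre, because the
      -- derivative of `g` is invertible on all of `W`.
      have h5 : ContDiffAt ℝ ∞ h.symm y := by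
        refine h.contDiffAt_symm hyt (f₀' := L') ?_ ?_
        · rw [hyh]; exact hL'
        · rw [hyh]; exact hgs _ hqW
      refine ContMDiffAt.contMDiffWithinAt (ContMDiffAt.comp (g := c.symm) y ?_ h5.contMDiffAt)
      have h6 : ContMDiffAt I4 I4 ∞ c.symm (h.symm y) := by
        rw [hyh]; exact contMDiffAt_symm_of_mem_maximalAtlas hc hqW.1
      exact h6
  · have := hsub hq
    rw [hs₁] at this
    exact this.2
  · have := hsub hq
    rw [hs₁] at this
    rw [hec]
    simp [hg, c.left_inv this.1.1]

/-- A function whose differential is a multiple of that of a coordinate is a function of that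
coordinate. -/
theorem exists_eq_comp_coordinate {e : OpenPartialHomeomorph M E4}
    (he : e ∈ IsManifold.maximalAtlas I4 ∞ M) {c : E4} {r : ℝ} (ht : e.target = Metric.ball c r)
    {f : M → ℝ} (hf : ∀ q ∈ e.source, ContMDiffAt I4 𝓘(ℝ, ℝ) ∞ f q) (i : Fin 4)
    (h : ∀ q ∈ e.source, ∀ v, dif (fun x => e x i) q v = 0 → dif f q v = 0) :
    ∃ F : ℝ → ℝ, ∀ q ∈ e.source, f q = F (e q i) ∧ ContDiffAt ℝ ∞ F (e q i) := by
  -- The line through the centre of the ball in the direction of coordinate `i`. Moving a point of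
  -- the ball to the point of this line with the same `i`-th coordinate does not increase the
  -- distance to `c`. The function sought is `f` along this line.
  set γ : ℝ → E4 := fun s => c + (s - c i) • EuclideanSpace.single i (1 : ℝ) with hγ
  have hγi : ∀ s, γ s i = s := fun s => by simp [hγ]
  have hγb : ∀ q ∈ e.source, γ (e q i) ∈ e.target := by
    intro q hq
    have h1 : e q ∈ Metric.ball c r := ht ▸ e.map_source hq
    rw [ht]
    rw [mem_ball_iff_norm] at h1 ⊢
    refine lt_of_le_of_lt ?_ h1
    simp only [hγ, add_sub_cancel_left, norm_smul, PiLp.norm_single, norm_one, mul_one]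
    exact PiLp.norm_apply_le (e q - c) i
  have hfy : ∀ y ∈ e.target, ContDiffAt ℝ ∞ (f ∘ e.symm) y := fun y hy =>
    contDiffAt_comp_chart_symm he hy (hf _ (e.map_target hy))
  have hker : ∀ y ∈ e.target, ∀ v : E4, v i = 0 → fderiv ℝ (f ∘ e.symm) y v = 0 := by
    intro y hy v hv
    rw [fderiv_comp_chart_symm he hy (hf _ (e.map_target hy))]
    refine h _ (e.map_target hy) _ ?_
    have h1 := dif_comp_chart he (e.map_target hy) (f := fun z : E4 => z i)
      (EuclideanSpace.proj i : E4 →L[ℝ] ℝ).contDiff.contDiffAt (mfderiv I4 I4 e.symm y v)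
    rw [mfderiv_symm_mfderiv_chart he hy] at h1
    refine h1.trans ?_
    rw [show (fun z : E4 => z i) = (EuclideanSpace.proj i : E4 →L[ℝ] ℝ) from rfl,
      ContinuousLinearMap.fderiv]
    exact hv
  refine ⟨fun s => f (e.symm (γ s)), fun q hq => ⟨?_, ?_⟩⟩
  · set y := e q with hy
    set z := γ (y i) with hz
    have hyt : y ∈ e.target := e.map_source hq
    have hzt : z ∈ e.target := hγb q hq
    -- The segment from `y` to its projection `z` stays in the convex target, and its direction has
    -- `i`-th coordinate zero; hence `f` is constant along it.
    have hseg : ∀ τ ∈ Set.Icc (0 : ℝ) 1, AffineMap.lineMap y z τ ∈ e.target := fun τ hτ => by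
      rw [ht] at *
      exact (convex_ball c r).lineMap_mem hyt hzt hτ
    have hd : ∀ τ ∈ Set.Icc (0 : ℝ) 1,
        HasDerivAt (fun τ => (f ∘ e.symm) (AffineMap.lineMap y z τ)) 0 τ := by
      intro τ hτ
      have h1 := ((hfy _ (hseg τ hτ)).differentiableAt (by simp)).hasFDerivAt.comp_hasDerivAt τ
        (AffineMap.hasDerivAt_lineMap (a := y) (b := z) (x := τ))
      rw [hker _ (hseg τ hτ) (z - y) (by simp [hz, hγi])] at h1
      exact h1
    have hc := constant_of_has_deriv_right_zero
      (f := fun τ => (f ∘ e.symm) (AffineMap.lineMap y z τ)) (a := 0) (b := 1)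
      (fun τ hτ => (hd τ hτ).continuousAt.continuousWithinAt)
      (fun τ hτ => (hd τ ⟨hτ.1, hτ.2.le⟩).hasDerivWithinAt) 1 (by simp)
    simp only [AffineMap.lineMap_apply_one, AffineMap.lineMap_apply_zero, Function.comp] at hc
    rw [hy, e.left_inv hq] at hc
    exact hc.symm
  · refine ContDiffAt.comp (e q i) (g := f ∘ e.symm) (f := γ) (hfy _ (hγb q hq)) ?_
    simp only [hγ]
    fun_prop

end LocalTools

/-! ### Rules for differentials -/

section DifCalculus

variable {M : Type*} [TopologicalSpace M] [ChartedSpace E4 M] {f g : M → ℝ} {p : M}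

theorem hasMFDerivAt_dif (hf : ContMDiffAt I4 𝓘(ℝ, ℝ) ∞ f p) :
    HasMFDerivAt I4 𝓘(ℝ, ℝ) f p (dif f p) :=
  (hf.mdifferentiableAt (by simp)).hasMFDerivAt

theorem dif_const (c : ℝ) : dif (fun _ : M => c) p = 0 :=
  mfderiv_const

theorem dif_add (hf : ContMDiffAt I4 𝓘(ℝ, ℝ) ∞ f p) (hg : ContMDiffAt I4 𝓘(ℝ, ℝ) ∞ g p) :
    dif (fun q => f q + g q) p = dif f p + dif g p :=
  ((hasMFDerivAt_dif hf).add (hasMFDerivAt_dif hg)).mfderiv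

theorem dif_mul (hf : ContMDiffAt I4 𝓘(ℝ, ℝ) ∞ f p) (hg : ContMDiffAt I4 𝓘(ℝ, ℝ) ∞ g p) :
    dif (fun q => f q * g q) p = f p • dif g p + g p • dif f p :=
  ((hasMFDerivAt_dif hf).mul (hasMFDerivAt_dif hg)).mfderiv

theorem dif_const_mul (c : ℝ) (hf : ContMDiffAt I4 𝓘(ℝ, ℝ) ∞ f p) :
    dif (fun q => c * f q) p = c • dif f p := by
  rw [dif_mul contMDiffAt_const hf, dif_const]; simp

theorem dif_mul_add_const (K C : ℝ) (hf : ContMDiffAt I4 𝓘(ℝ, ℝ) ∞ f p) :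
    dif (fun q => K * f q + C) p = K • dif f p := by
  rw [dif_add (f := fun q => K * f q) (contMDiffAt_const.mul hf) contMDiffAt_const, dif_const_mul K hf, dif_const, add_zero]

end DifCalculus

/-! ### The three classes through common coefficients `α, β₀, β₁` -/

namespace SepClass

/-- The coefficient of `dφ` in `σ_ξ`. -/
def coeffXi : SepClass → ℝ → ℝ
  | PT, _ => 0
  | CT, t => t
  | OT, t => t

/-- The coefficient of `dψ` in `σ_η`. -/
def coeffEtaPsi : SepClass → ℝ
  | PT => 0
  | CT => 0
  | OT => 1

/-- The coefficient of `dφ` in `σ_η`. -/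
def coeffEtaPhi : SepClass → ℝ → ℝ
  | PT, _ => 1
  | CT, s => s
  | OT, s => s

/-- The derivative of `coeffXi`. -/
def slopeXi : SepClass → ℝ
  | PT => 0
  | CT => 1
  | OT => 1

/-- The derivative of `coeffEtaPhi`. -/
def slopeEtaPhi : SepClass → ℝ
  | PT => 0
  | CT => 1
  | OT => 1

theorem sigXi_eq {V : Type*} [AddCommGroup V] [Module ℝ V] (c : SepClass) (t : ℝ) (dψ dφ : V) :
    c.sigXi t dψ dφ = dψ + c.coeffXi t • dφ := by
  cases c <;> simp [sigXi, coeffXi]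

theorem sigEta_eq {V : Type*} [AddCommGroup V] [Module ℝ V] (c : SepClass) (s : ℝ) (dψ dφ : V) :
    c.sigEta s dψ dφ = c.coeffEtaPsi • dψ + c.coeffEtaPhi s • dφ := by
  cases c <;> simp [sigEta, coeffEtaPsi, coeffEtaPhi]

/-- This is the determinant of `dP, dQ` with respect to `dξ, dη`, compare `dif_P` and `dif_Q`. -/
theorem Sig_eq (c : SepClass) (s t : ℝ) :
    c.Sig s t = c.coeffEtaPhi s - c.coeffXi t * c.coeffEtaPsi := by
  cases c <;> simp [Sig, coeffXi, coeffEtaPsi, coeffEtaPhi]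

variable {M : Type*} [TopologicalSpace M] [ChartedSpace E4 M] {ξ η : M → ℝ} {p : M}

theorem contMDiffAt_P (c : SepClass) (hξ : ContMDiffAt I4 𝓘(ℝ, ℝ) ∞ ξ p)
    (hη : ContMDiffAt I4 𝓘(ℝ, ℝ) ∞ η p) :
    ContMDiffAt I4 𝓘(ℝ, ℝ) ∞ (fun q => c.P (ξ q) (η q)) p := by
  cases c
  · exact hξ
  · exact hξ
  · exact hξ.add hη

theorem contMDiffAt_Q (c : SepClass) (hξ : ContMDiffAt I4 𝓘(ℝ, ℝ) ∞ ξ p)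
    (hη : ContMDiffAt I4 𝓘(ℝ, ℝ) ∞ η p) :
    ContMDiffAt I4 𝓘(ℝ, ℝ) ∞ (fun q => c.Q (ξ q) (η q)) p := by
  cases c
  · exact hη
  · exact hξ.mul hη
  · exact hξ.mul hη

theorem dif_P (c : SepClass) (hξ : ContMDiffAt I4 𝓘(ℝ, ℝ) ∞ ξ p)
    (hη : ContMDiffAt I4 𝓘(ℝ, ℝ) ∞ η p) :
    dif (fun q => c.P (ξ q) (η q)) p = dif ξ p + c.coeffEtaPsi • dif η p := by
  cases c
  · simp [P, coeffEtaPsi]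
  · simp [P, coeffEtaPsi]
  · simp [P, coeffEtaPsi, dif_add hξ hη]

theorem dif_Q (c : SepClass) (hξ : ContMDiffAt I4 𝓘(ℝ, ℝ) ∞ ξ p)
    (hη : ContMDiffAt I4 𝓘(ℝ, ℝ) ∞ η p) :
    dif (fun q => c.Q (ξ q) (η q)) p =
      c.coeffXi (η p) • dif ξ p + c.coeffEtaPhi (ξ p) • dif η p := by
  cases c
  · simp [Q, coeffXi, coeffEtaPhi]
  · simp [Q, coeffXi, coeffEtaPhi, dif_mul hξ hη, add_comm]
  · simp [Q, coeffXi, coeffEtaPhi, dif_mul hξ hη, add_comm]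

theorem contMDiffAt_coeffXi (c : SepClass) (hη : ContMDiffAt I4 𝓘(ℝ, ℝ) ∞ η p) :
    ContMDiffAt I4 𝓘(ℝ, ℝ) ∞ (fun q => c.coeffXi (η q)) p := by
  cases c
  · exact contMDiffAt_const
  · exact hη
  · exact hη

theorem contMDiffAt_coeffEtaPhi (c : SepClass) (hξ : ContMDiffAt I4 𝓘(ℝ, ℝ) ∞ ξ p) :
    ContMDiffAt I4 𝓘(ℝ, ℝ) ∞ (fun q => c.coeffEtaPhi (ξ q)) p := by
  cases c
  · exact contMDiffAt_const
  · exact hξ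
  · exact hξ

theorem dif_coeffXi (c : SepClass) :
    dif (fun q => c.coeffXi (η q)) p = c.slopeXi • dif η p := by
  cases c
  · simp [coeffXi, slopeXi, dif_const]
  · simp [coeffXi, slopeXi]
  · simp [coeffXi, slopeXi]

theorem dif_coeffEtaPhi (c : SepClass) :
    dif (fun q => c.coeffEtaPhi (ξ q)) p = c.slopeEtaPhi • dif ξ p := by
  cases c
  · simp [coeffEtaPhi, slopeEtaPhi, dif_const]
  · simp [coeffEtaPhi, slopeEtaPhi]
  · simp [coeffEtaPhi, slopeEtaPhi]

end SepClass

/-! ### Linear algebra at a point -/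

section Algebra

variable {V : Type*} [AddCommGroup V] [Module ℝ V]

/-- The linear algebra at a point, for a metric `g` and a complex structure `J`, in terms of the
frame `n₀, n₁, J n₀, J n₁` with Hamiltonian covectors `αₖ dξ + βₖ dη`, where `α₀ = 1`. -/
structure IsHamiltonianFrame (g : V →ₗ[ℝ] V →ₗ[ℝ] ℝ) (J : V →ₗ[ℝ] V) (n₀ n₁ : V)
    (dξ dη : V →ₗ[ℝ] ℝ) (α β₀ β₁ : ℝ) : Prop where
  symm : ∀ v w, g v w = g w v
  pos : ∀ v, v ≠ 0 → 0 < g v v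
  cplx_sq : ∀ v, J (J v) = -v
  isometry : ∀ v w, g (J v) (J w) = g v w
  span : ∀ v, ∃ c₀ c₁ c₂ c₃ : ℝ, v = c₀ • n₀ + c₁ • n₁ + c₂ • J n₀ + c₃ • J n₁
  ham₀ : ∀ v, g (J n₀) v = -(dξ v + β₀ * dη v)
  ham₁ : ∀ v, g (J n₁) v = -(α * dξ v + β₁ * dη v)
  xi₀ : dξ n₀ = 0
  xi₁ : dξ n₁ = 0
  eta₀ : dη n₀ = 0
  eta₁ : dη n₁ = 0
  xi_ne : dξ ≠ 0
  eta_ne : dη ≠ 0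
  orth : ∃ u, (∀ w, g u w = dξ w) ∧ dη u = 0
  det_ne : β₁ - α * β₀ ≠ 0

namespace IsHamiltonianFrame

variable {g : V →ₗ[ℝ] V →ₗ[ℝ] ℝ} {J : V →ₗ[ℝ] V} {n₀ n₁ : V} {dξ dη : V →ₗ[ℝ] ℝ} {α β₀ β₁ : ℝ}

/-- The numbers are `a = |dξ|²` and `b = |dη|²`. Pairing `J n₀, J n₁` with the metric duals of `dξ`
and `dη` reduces each value to these norms, the mixed term vanishing by orthogonality. They
determine the whole metric. -/
theorem exists_norms (h : IsHamiltonianFrame g J n₀ n₁ dξ dη α β₀ β₁) : ∃ a b : ℝ, a ≠ 0 ∧ b ≠ 0 ∧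
    dξ (J n₀) = -a ∧ dξ (J n₁) = -(a * α) ∧ dη (J n₀) = -(b * β₀) ∧ dη (J n₁) = -(b * β₁) := by
  obtain ⟨u, hu, hηu⟩ := h.orth
  set S := β₁ - α * β₀ with hS
  have hS0 : S ≠ 0 := h.det_ne
  set u' := S⁻¹ • (α • J n₀ - J n₁) with hu'
  have hu'η : ∀ w, g u' w = dη w := by
    intro w
    simp only [hu', map_smul, map_sub, LinearMap.smul_apply, LinearMap.sub_apply, smul_eq_mul,
      h.ham₀, h.ham₁]
    field_simp
    rw [hS]; ring
  have hξu' : dξ u' = 0 := by rw [← hu, h.symm, hu'η, hηu]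
  have hu0 : u ≠ 0 := by
    rintro rfl
    exact h.xi_ne (LinearMap.ext fun w => by rw [← hu]; simp)
  have hu'0 : u' ≠ 0 := by
    intro h0
    exact h.eta_ne (LinearMap.ext fun w => by rw [← hu'η, h0]; simp)
  refine ⟨dξ u, dη u', ?_, ?_, ?_, ?_, ?_, ?_⟩
  · rw [← hu]; exact (h.pos u hu0).ne'
  · rw [← hu'η]; exact (h.pos u' hu'0).ne'
  · rw [← hu, h.symm, h.ham₀, hηu]; ring
  · rw [← hu, h.symm, h.ham₁, hηu]; ring
  · rw [← hu'η, h.symm, h.ham₀, hξu', ← hu'η]; ring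
  · rw [← hu'η, h.symm, h.ham₁, hξu', ← hu'η]; ring

theorem profile_ne_zero (h : IsHamiltonianFrame g J n₀ n₁ dξ dη α β₀ β₁) :
    β₀ * dξ (J n₁) - β₁ * dξ (J n₀) ≠ 0 ∧ α * dη (J n₀) - dη (J n₁) ≠ 0 := by
  obtain ⟨a, b, ha, hb, h1, h2, h3, h4⟩ := h.exists_norms
  have hS0 := h.det_ne
  constructor
  · rw [h1, h2]
    have := mul_ne_zero ha hS0
    intro h0; apply this; linarith
  · rw [h3, h4]
    have := mul_ne_zero hb hS0
    intro h0; apply this; linarith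

/-- Both sides agree on the frame. The planes of `n₀, n₁` and of `J n₀, J n₁` are orthogonal since
`dξ, dη` kill `n₀, n₁`; the isometry `J` identifies their Gram matrices, which are given by `a` and
`b`; and `F = aS`, `G = bS`. -/
theorem metric_eq (h : IsHamiltonianFrame g J n₀ n₁ dξ dη α β₀ β₁) {dψ dφ : V →ₗ[ℝ] ℝ}
    (hψ₀ : dψ n₀ = 1) (hψ₁ : dψ n₁ = 0) (hψ₂ : dψ (J n₀) = 0) (hψ₃ : dψ (J n₁) = 0)
    (hφ₀ : dφ n₀ = 0) (hφ₁ : dφ n₁ = 1) (hφ₂ : dφ (J n₀) = 0) (hφ₃ : dφ (J n₁) = 0) {F G S : ℝ}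
    (hF : F = β₀ * dξ (J n₁) - β₁ * dξ (J n₀)) (hG : G = α * dη (J n₀) - dη (J n₁))
    (hS : S = β₁ - α * β₀) (v w : V) :
    g v w = S * (dξ v * dξ w / F + dη v * dη w / G)
      + 1 / S * (F * ((dψ v + α * dφ v) * (dψ w + α * dφ w))
        + G * ((β₀ * dψ v + β₁ * dφ v) * (β₀ * dψ w + β₁ * dφ w))) := by
  obtain ⟨a, b, ha, hb, h1, h2, h3, h4⟩ := h.exists_norms
  have hS0 : S ≠ 0 := hS ▸ h.det_ne
  have hF' : F = a * S := by rw [hF, h1, h2, hS]; ring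
  have hG' : G = b * S := by rw [hG, h3, h4, hS]; ring
  obtain ⟨c₀, c₁, c₂, c₃, rfl⟩ := h.span v
  obtain ⟨d₀, d₁, d₂, d₃, rfl⟩ := h.span w
  have e₀₂ : g n₀ (J n₀) = 0 := by rw [h.symm, h.ham₀, h.xi₀, h.eta₀]; ring
  have e₀₃ : g n₀ (J n₁) = 0 := by rw [h.symm, h.ham₁, h.xi₀, h.eta₀]; ring
  have e₁₂ : g n₁ (J n₀) = 0 := by rw [h.symm, h.ham₀, h.xi₁, h.eta₁]; ring
  have e₁₃ : g n₁ (J n₁) = 0 := by rw [h.symm, h.ham₁, h.xi₁, h.eta₁]; ring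
  have e₀₀ : g n₀ n₀ = a + b * β₀ * β₀ := by rw [← h.isometry, h.ham₀, h1, h3]; ring
  have e₀₁ : g n₀ n₁ = a * α + b * β₀ * β₁ := by rw [← h.isometry, h.ham₀, h2, h4]; ring
  have e₁₀ : g n₁ n₀ = a * α + b * β₀ * β₁ := by rw [h.symm, e₀₁]
  have e₁₁ : g n₁ n₁ = a * α * α + b * β₁ * β₁ := by rw [← h.isometry, h.ham₁, h2, h4]; ring
  simp only [map_add, map_smul, LinearMap.add_apply, LinearMap.smul_apply, smul_eq_mul,
    h.ham₀, h.ham₁, e₀₀, e₀₁, e₁₀, e₁₁, e₀₂, e₀₃, e₁₂, e₁₃, h.xi₀, h.xi₁, h.eta₀, h.eta₁,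
    h1, h2, h3, h4, hψ₀, hψ₁, hψ₂, hψ₃, hφ₀, hφ₁, hφ₂, hφ₃]
  rw [hF', hG']
  field_simp
  ring

theorem form_eq (h : IsHamiltonianFrame g J n₀ n₁ dξ dη α β₀ β₁) {dψ dφ : V →ₗ[ℝ] ℝ}
    (hψ₀ : dψ n₀ = 1) (hψ₁ : dψ n₁ = 0) (hψ₂ : dψ (J n₀) = 0) (hψ₃ : dψ (J n₁) = 0)
    (hφ₀ : dφ n₀ = 0) (hφ₁ : dφ n₁ = 1) (hφ₂ : dφ (J n₀) = 0) (hφ₃ : dφ (J n₁) = 0) (v w : V) :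
    g (J v) w = ((dξ v + β₀ * dη v) * dψ w - (dξ w + β₀ * dη w) * dψ v)
      + ((α * dξ v + β₁ * dη v) * dφ w - (α * dξ w + β₁ * dη w) * dφ v) := by
  obtain ⟨a, b, ha, hb, h1, h2, h3, h4⟩ := h.exists_norms
  obtain ⟨c₀, c₁, c₂, c₃, rfl⟩ := h.span v
  obtain ⟨d₀, d₁, d₂, d₃, rfl⟩ := h.span w
  have e₀₂ : g n₀ (J n₀) = 0 := by rw [h.symm, h.ham₀, h.xi₀, h.eta₀]; ring
  have e₀₃ : g n₀ (J n₁) = 0 := by rw [h.symm, h.ham₁, h.xi₀, h.eta₀]; ring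
  have e₁₂ : g n₁ (J n₀) = 0 := by rw [h.symm, h.ham₀, h.xi₁, h.eta₁]; ring
  have e₁₃ : g n₁ (J n₁) = 0 := by rw [h.symm, h.ham₁, h.xi₁, h.eta₁]; ring
  have e₀₀ : g n₀ n₀ = a + b * β₀ * β₀ := by rw [← h.isometry, h.ham₀, h1, h3]; ring
  have e₀₁ : g n₀ n₁ = a * α + b * β₀ * β₁ := by rw [← h.isometry, h.ham₀, h2, h4]; ring
  have e₁₀ : g n₁ n₀ = a * α + b * β₀ * β₁ := by rw [h.symm, e₀₁]
  have e₁₁ : g n₁ n₁ = a * α * α + b * β₁ * β₁ := by rw [← h.isometry, h.ham₁, h2, h4]; ring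
  simp only [map_add, map_smul, map_neg, LinearMap.add_apply, LinearMap.smul_apply,
    LinearMap.neg_apply, smul_eq_mul, h.cplx_sq,
    h.ham₀, h.ham₁, e₀₀, e₀₁, e₁₀, e₁₁, e₀₂, e₀₃, e₁₂, e₁₃, h.xi₀, h.xi₁, h.eta₀, h.eta₁,
    h1, h2, h3, h4, hψ₀, hψ₁, hψ₂, hψ₃, hφ₀, hφ₁, hφ₂, hφ₃]
  ring

/-- The covectors dual to `J n₀` and `J n₁`. -/
theorem dual_covectors_eq (h : IsHamiltonianFrame g J n₀ n₁ dξ dη α β₀ β₁) {y₀ y₁ : V →ₗ[ℝ] ℝ}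
    (h₀₀ : y₀ n₀ = 0) (h₀₁ : y₀ n₁ = 0) (h₀₂ : y₀ (J n₀) = 1) (h₀₃ : y₀ (J n₁) = 0)
    (h₁₀ : y₁ n₀ = 0) (h₁₁ : y₁ n₁ = 0) (h₁₂ : y₁ (J n₀) = 0) (h₁₃ : y₁ (J n₁) = 1) {F G : ℝ}
    (hF : F = β₀ * dξ (J n₁) - β₁ * dξ (J n₀)) (hG : G = α * dη (J n₀) - dη (J n₁)) (v : V) :
    y₀ v = -(β₁ * F⁻¹) * dξ v + α * G⁻¹ * dη v ∧ y₁ v = β₀ * F⁻¹ * dξ v + -G⁻¹ * dη v := by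
  obtain ⟨a, b, ha, hb, h1, h2, h3, h4⟩ := h.exists_norms
  have hS0 := h.det_ne
  obtain ⟨S, hS⟩ : ∃ S, S = β₁ - α * β₀ := ⟨_, rfl⟩
  have hF' : F = a * S := by rw [hF, h1, h2, hS]; ring
  have hG' : G = b * S := by rw [hG, h3, h4, hS]; ring
  rw [← hS] at hS0
  obtain ⟨c₀, c₁, c₂, c₃, rfl⟩ := h.span v
  simp only [map_add, map_smul, smul_eq_mul, h.xi₀, h.xi₁, h.eta₀, h.eta₁, h1, h2, h3, h4,
    h₀₀, h₀₁, h₀₂, h₀₃, h₁₀, h₁₁, h₁₂, h₁₃]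
  rw [hF', hG']
  constructor
  · field_simp
    rw [hS]
    ring
  · field_simp
    rw [hS]
    ring

end IsHamiltonianFrame

end Algebra

/-! ### Separable functions are bilinear in the coordinates -/

section Bilinear

theorem contMDiffAt_bilinear {M : Type*} [TopologicalSpace M] [ChartedSpace E4 M] {ξ η : M → ℝ}
    {p : M} (k a b w : ℝ) (hξ : ContMDiffAt I4 𝓘(ℝ, ℝ) ∞ ξ p)
    (hη : ContMDiffAt I4 𝓘(ℝ, ℝ) ∞ η p) :
    ContMDiffAt I4 𝓘(ℝ, ℝ) ∞ (fun q => k + a * ξ q + b * η q + w * (ξ q * η q)) p :=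
  ((contMDiffAt_const.add (contMDiffAt_const.mul hξ)).add (contMDiffAt_const.mul hη)).add
    (contMDiffAt_const.mul (hξ.mul hη))

theorem dif_bilinear {M : Type*} [TopologicalSpace M] [ChartedSpace E4 M] {ξ η : M → ℝ} {p : M}
    (k a b w : ℝ) (hξ : ContMDiffAt I4 𝓘(ℝ, ℝ) ∞ ξ p) (hη : ContMDiffAt I4 𝓘(ℝ, ℝ) ∞ η p) :
    dif (fun q => k + a * ξ q + b * η q + w * (ξ q * η q)) p =
      (a + w * η p) • dif ξ p + (b + w * ξ p) • dif η p := by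
  have s1 : ContMDiffAt I4 𝓘(ℝ, ℝ) ∞ (fun q => a * ξ q) p := contMDiffAt_const.mul hξ
  have s2 : ContMDiffAt I4 𝓘(ℝ, ℝ) ∞ (fun q => b * η q) p := contMDiffAt_const.mul hη
  have s3 : ContMDiffAt I4 𝓘(ℝ, ℝ) ∞ (fun q => ξ q * η q) p := hξ.mul hη
  have s4 : ContMDiffAt I4 𝓘(ℝ, ℝ) ∞ (fun q => w * (ξ q * η q)) p := contMDiffAt_const.mul s3
  have s5 : ContMDiffAt I4 𝓘(ℝ, ℝ) ∞ (fun q => k + a * ξ q) p := contMDiffAt_const.add s1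
  have s6 : ContMDiffAt I4 𝓘(ℝ, ℝ) ∞ (fun q => k + a * ξ q + b * η q) p := s5.add s2
  rw [dif_add s6 s4, dif_add s5 s2, dif_add contMDiffAt_const s1, dif_const, dif_const_mul _ hξ,
    dif_const_mul _ hη, dif_const_mul _ s3, dif_mul hξ hη]
  ext y
  simp only [add_apply, smul_apply, smul_eq_mul, zero_apply]
  ring

variable {M : Type*} [TopologicalSpace M] [ChartedSpace E4 M] [IsManifold I4 ∞ M]

/-- `d² f = 0` equates the two mixed derivatives `u'` and `v'`. Then `d² u = 0` and `d² v = 0` give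
`du' ∧ dη = 0` and `du' ∧ dξ = 0`, so `u'` is a constant `w`, and integrating twice over the
connected set gives the polynomial. -/
theorem exists_bilinear_of_partials {U : Set M} (hU : IsOpen U) (hUc : IsConnected U)
    {f ξ η u v u' v' : M → ℝ} (hf : ∀ p ∈ U, ContMDiffAt I4 𝓘(ℝ, ℝ) ∞ f p)
    (hξ : ∀ p ∈ U, ContMDiffAt I4 𝓘(ℝ, ℝ) ∞ ξ p) (hη : ∀ p ∈ U, ContMDiffAt I4 𝓘(ℝ, ℝ) ∞ η p)
    (hu : ∀ p ∈ U, ContMDiffAt I4 𝓘(ℝ, ℝ) ∞ u p) (hv : ∀ p ∈ U, ContMDiffAt I4 𝓘(ℝ, ℝ) ∞ v p)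
    (hdual : ∀ p ∈ U, ∃ e₁ e₂, dif ξ p e₁ = 1 ∧ dif ξ p e₂ = 0 ∧ dif η p e₁ = 0 ∧ dif η p e₂ = 1)
    (hX : ∀ p ∈ U, ∃ X : (q : M) → TangentSpace I4 q,
      (∀ q ∈ U, SmoothFieldAt X q) ∧ dif η p (X p) ≠ 0)
    (hdf : ∀ p ∈ U, dif f p = u p • dif ξ p + v p • dif η p)
    (hdu : ∀ p ∈ U, dif u p = u' p • dif η p) (hdv : ∀ p ∈ U, dif v p = v' p • dif ξ p) :
    ∃ k a b w : ℝ, ∀ p ∈ U, f p = k + a * ξ p + b * η p + w * (ξ p * η p) := by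
  have ev : ∀ {g : M → ℝ}, (∀ p ∈ U, ContMDiffAt I4 𝓘(ℝ, ℝ) ∞ g p) → ∀ p ∈ U,
      ∀ᶠ q in 𝓝 p, ContMDiffAt I4 𝓘(ℝ, ℝ) ∞ g q := fun hg p hp => by
    filter_upwards [hU.mem_nhds hp] with q hq using hg q hq
  have huv : ∀ p ∈ U, v' p = u' p := by
    intro p hp
    obtain ⟨e₁, e₂, h1, h2, h3, h4⟩ := hdual p hp
    have := wedge_add_wedge_eq_zero (ev hf p hp) (hu p hp) (hv p hp) (ev hξ p hp) (ev hη p hp)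
      (by filter_upwards [hU.mem_nhds hp] with q hq using hdf q hq) e₁ e₂
    simp only [wedge, hdu p hp, hdv p hp, smul_apply, smul_eq_mul, h1, h2, h3, h4] at this
    linarith
  -- No smoothness of `u'` is given; it follows from `u' = du(X) / dη(X)` for a smooth field `X`
  -- with `dη(X) ≠ 0` at the point.
  have hu's : ∀ p ∈ U, ContMDiffAt I4 𝓘(ℝ, ℝ) ∞ u' p := by
    intro p hp
    obtain ⟨X, hXs, hX0⟩ := hX p hp
    have h1 := contMDiffAt_dif_apply (ev hη p hp) (hXs p hp)
    have h2 := contMDiffAt_dif_apply (ev hu p hp) (hXs p hp)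
    refine (h2.mul (h1.inv₀ hX0)).congr_of_eventuallyEq ?_
    filter_upwards [hU.mem_nhds hp, h1.continuousAt.eventually_ne hX0] with q hq hq0
    simp only [Pi.mul_apply, hdu q hq, smul_apply, smul_eq_mul]
    field_simp
  have hdu' : ∀ p ∈ U, dif u' p = 0 := by
    intro p hp
    obtain ⟨e₁, e₂, h1, h2, h3, h4⟩ := hdual p hp
    have w1 := fun a b => wedge_add_wedge_eq_zero (f := u) (u := fun _ => 0) (v := u') (ξ := ξ)
      (η := η) (ev hu p hp) contMDiffAt_const (hu's p hp) (ev hξ p hp) (ev hη p hp)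
      (by filter_upwards [hU.mem_nhds hp] with q hq; simp [hdu q hq]) a b
    have w2 := fun a b => wedge_add_wedge_eq_zero (f := v) (u := u') (v := fun _ => 0) (ξ := ξ)
      (η := η) (ev hv p hp) (hu's p hp) contMDiffAt_const (ev hξ p hp) (ev hη p hp)
      (by filter_upwards [hU.mem_nhds hp] with q hq; simp [hdv q hq, huv q hq]) a b
    simp only [wedge, dif_const, zero_apply, zero_mul, sub_zero, zero_add, add_zero] at w1 w2
    have h5 : dif u' p e₂ = 0 := by
      have := w2 e₂ e₁
      rw [h1, h2] at this; linarith
    ext y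
    have := w1 y e₂
    rw [h4, h5] at this
    simp only [zero_apply]; linarith
  obtain ⟨p₀, hp₀⟩ := hUc.nonempty
  set w := u' p₀ with hw
  have hu'c : ∀ p ∈ U, u' p = w := fun p hp =>
    eq_of_dif_eq_zero hU hUc.isPreconnected hu's hdu' hp hp₀
  have cm : ∀ (c : ℝ) {g : M → ℝ} {p}, ContMDiffAt I4 𝓘(ℝ, ℝ) ∞ g p →
      ContMDiffAt I4 𝓘(ℝ, ℝ) ∞ (fun q => c * g q) p := fun c _ _ hg => contMDiffAt_const.mul hg
  have hac : ∀ p ∈ U, u p + -w * η p = u p₀ + -w * η p₀ := fun p hp =>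
    eq_of_dif_eq_zero (f := fun q => u q + -w * η q) hU hUc.isPreconnected
      (fun q hq => (hu q hq).add (cm _ (hη q hq)))
      (fun q hq => by
        rw [dif_add (hu q hq) (cm _ (hη q hq)), dif_const_mul _ (hη q hq), hdu q hq, hu'c q hq]
        ext; simp) hp hp₀
  have hbc : ∀ p ∈ U, v p + -w * ξ p = v p₀ + -w * ξ p₀ := fun p hp =>
    eq_of_dif_eq_zero (f := fun q => v q + -w * ξ q) hU hUc.isPreconnected
      (fun q hq => (hv q hq).add (cm _ (hξ q hq)))
      (fun q hq => by
        rw [dif_add (hv q hq) (cm _ (hξ q hq)), dif_const_mul _ (hξ q hq), hdv q hq, huv q hq,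
          hu'c q hq]
        ext; simp) hp hp₀
  set a := u p₀ + -w * η p₀ with ha
  set b := v p₀ + -w * ξ p₀ with hb
  have hkc : ∀ p ∈ U, f p + (0 + -a * ξ p + -b * η p + -w * (ξ p * η p))
      = f p₀ + (0 + -a * ξ p₀ + -b * η p₀ + -w * (ξ p₀ * η p₀)) := fun p hp =>
    eq_of_dif_eq_zero (f := fun q => f q + (0 + -a * ξ q + -b * η q + -w * (ξ q * η q)))
      hU hUc.isPreconnected
      (fun q hq => (hf q hq).add (contMDiffAt_bilinear _ _ _ _ (hξ q hq) (hη q hq)))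
      (fun q hq => by
        rw [dif_add (hf q hq) (contMDiffAt_bilinear _ _ _ _ (hξ q hq) (hη q hq)),
          dif_bilinear _ _ _ _ (hξ q hq) (hη q hq), hdf q hq]
        have e1 : u q = a + w * η q := by have := hac q hq; linarith
        have e2 : v q = b + w * ξ q := by have := hbc q hq; linarith
        ext y
        simp only [add_apply, smul_apply, smul_eq_mul, zero_apply, e1, e2]
        ring) hp hp₀
  refine ⟨f p₀ + (0 + -a * ξ p₀ + -b * η p₀ + -w * (ξ p₀ * η p₀)), a, b, w, fun p hp => ?_⟩
  have := hkc p hp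
  linarith

end Bilinear

/-! ### The commuting frame `m₁, m₂, I m₁, I m₂` -/

namespace ToricKahlerSurface

variable {M : Type*} [TopologicalSpace M] [ChartedSpace E4 M] [IsManifold I4 ∞ M]
variable (T : ToricKahlerSurface M)

/-- The metric at a point, as a bilinear form. -/
def bilin (p : M) : TangentSpace I4 p →ₗ[ℝ] TangentSpace I4 p →ₗ[ℝ] ℝ :=
  LinearMap.mk₂ ℝ (fun v w => T.metric.inner p v w) (by simp) (by simp) (by simp) (by simp)

theorem bilin_apply (p : M) (v w : TangentSpace I4 p) : T.bilin p v w = T.metric.inner p v w := rfl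

/-- The frame `m₁, m₂, I m₁, I m₂`. -/
def frame : Fin 4 → (p : M) → TangentSpace I4 p
  | 0 => T.m 0
  | 1 => T.m 1
  | 2 => fun p => T.cplx p (T.m 0 p)
  | 3 => fun p => T.cplx p (T.m 1 p)

theorem smoothFieldAt_cplx {X : (q : M) → TangentSpace I4 q} {p : M} (hX : SmoothFieldAt X p) :
    SmoothFieldAt (fun q => T.cplx q (X q)) p :=
  ContMDiffAt.clm_bundle_apply (T.cplx_smooth p) hX

theorem smoothFieldAt_frame (l : Fin 4) (p : M) : SmoothFieldAt (T.frame l) p := by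
  fin_cases l
  · exact T.m_smooth 0 p
  · exact T.m_smooth 1 p
  · exact T.smoothFieldAt_cplx (T.m_smooth 0 p)
  · exact T.smoothFieldAt_cplx (T.m_smooth 1 p)

theorem mlieBracket_m_cplx (i j : Fin 2) (p : M) :
    VectorField.mlieBracket I4 (T.m i) (fun q => T.cplx q (T.m j q)) p = 0 := by
  rw [T.m_holomorphic i p _ (T.m_smooth j p), T.m_comm, map_zero]

theorem mlieBracket_cplx_m (i j : Fin 2) (p : M) :
    VectorField.mlieBracket I4 (fun q => T.cplx q (T.m i q)) (T.m j) p = 0 := by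
  rw [VectorField.mlieBracket_swap_apply, mlieBracket_m_cplx, neg_zero]

/-- In the Nijenhuis tensor of `m i, m j` the other three brackets vanish. -/
theorem mlieBracket_cplx_cplx (i j : Fin 2) (p : M) :
    VectorField.mlieBracket I4 (fun q => T.cplx q (T.m i q)) (fun q => T.cplx q (T.m j q)) p
      = 0 := by
  have := T.integrable p _ _ (T.m_smooth i p) (T.m_smooth j p)
  rwa [mlieBracket_m_cplx, mlieBracket_cplx_m, T.m_comm, map_zero, sub_zero, sub_zero,
    sub_zero] at this

theorem mlieBracket_frame (k l : Fin 4) (p : M) :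
    VectorField.mlieBracket I4 (T.frame k) (T.frame l) p = 0 := by
  match k, l with
  | 0, 0 => exact T.m_comm 0 0 p
  | 0, 1 => exact T.m_comm 0 1 p
  | 0, 2 => exact T.mlieBracket_m_cplx 0 0 p
  | 0, 3 => exact T.mlieBracket_m_cplx 0 1 p
  | 1, 0 => exact T.m_comm 1 0 p
  | 1, 1 => exact T.m_comm 1 1 p
  | 1, 2 => exact T.mlieBracket_m_cplx 1 0 p
  | 1, 3 => exact T.mlieBracket_m_cplx 1 1 p
  | 2, 0 => exact T.mlieBracket_cplx_m 0 0 p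
  | 2, 1 => exact T.mlieBracket_cplx_m 0 1 p
  | 2, 2 => exact T.mlieBracket_cplx_cplx 0 0 p
  | 2, 3 => exact T.mlieBracket_cplx_cplx 0 1 p
  | 3, 0 => exact T.mlieBracket_cplx_m 1 0 p
  | 3, 1 => exact T.mlieBracket_cplx_m 1 1 p
  | 3, 2 => exact T.mlieBracket_cplx_cplx 1 0 p
  | 3, 3 => exact T.mlieBracket_cplx_cplx 1 1 p

theorem gram_ne_zero {p : M} (hp : p ∉ T.axis) :
    T.metric.inner p (T.m 0 p) (T.m 0 p) * T.metric.inner p (T.m 1 p) (T.m 1 p)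
      - T.metric.inner p (T.m 0 p) (T.m 1 p) * T.metric.inner p (T.m 1 p) (T.m 0 p) ≠ 0 := by
  intro h
  apply hp
  simpa [axis, Matrix.det_fin_two] using h

theorem inner_m_cplx_m {p : M} (h0 : ∀ i j, dif (T.x i) p (T.m j p) = 0) (i j : Fin 2) :
    T.metric.inner p (T.m i p) (T.cplx p (T.m j p)) = 0 := by
  rw [T.metric.symm, T.hamiltonian, h0, neg_zero]

/-- The planes of `m₁, m₂` and `I m₁, I m₂` are orthogonal, because the moment maps are invariant,
and both have the same Gram matrix, which is nonsingular off the axis. -/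
theorem linearIndependent_frame {p : M} (hp : p ∉ T.axis)
    (h0 : ∀ i j, dif (T.x i) p (T.m j p) = 0) : LinearIndependent ℝ fun l => T.frame l p := by
  have hG := T.gram_ne_zero hp
  have z := T.inner_m_cplx_m h0
  have z' : ∀ i j, T.metric.inner p (T.cplx p (T.m i p)) (T.m j p) = 0 := fun i j => by
    rw [T.metric.symm, z]
  set G₀₀ := T.metric.inner p (T.m 0 p) (T.m 0 p)
  set G₁₁ := T.metric.inner p (T.m 1 p) (T.m 1 p)
  set G₀₁ := T.metric.inner p (T.m 0 p) (T.m 1 p)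
  set G₁₀ := T.metric.inner p (T.m 1 p) (T.m 0 p)
  have solve : ∀ s t : ℝ, s * G₀₀ + t * G₀₁ = 0 → s * G₁₀ + t * G₁₁ = 0 → s = 0 ∧ t = 0 := by
    intro s t h1 h2
    constructor
    · apply (mul_eq_zero.1 (_ : s * (G₀₀ * G₁₁ - G₀₁ * G₁₀) = 0)).resolve_right hG
      linear_combination G₁₁ * h1 - G₀₁ * h2
    · apply (mul_eq_zero.1 (_ : t * (G₀₀ * G₁₁ - G₀₁ * G₁₀) = 0)).resolve_right hG
      linear_combination G₀₀ * h2 - G₁₀ * h1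
  rw [Fintype.linearIndependent_iff]
  intro c hc
  have hc' : c 0 • T.m 0 p + c 1 • T.m 1 p + c 2 • T.cplx p (T.m 0 p) + c 3 • T.cplx p (T.m 1 p)
      = 0 := by
    rw [← hc, Fin.sum_univ_four]; rfl
  have e := fun v => congrArg (T.metric.inner p v) hc'
  simp only [map_add, map_smul, map_zero, smul_eq_mul] at e
  have e0 := e (T.m 0 p)
  have e1 := e (T.m 1 p)
  have e2 := e (T.cplx p (T.m 0 p))
  have e3 := e (T.cplx p (T.m 1 p))
  simp only [z, z', T.cplx_isometry, mul_zero, add_zero, zero_add] at e0 e1 e2 e3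
  obtain ⟨h0, h1⟩ := solve _ _ e0 e1
  obtain ⟨h2, h3⟩ := solve _ _ e2 e3
  intro l
  fin_cases l
  · exact h0
  · exact h1
  · exact h2
  · exact h3

theorem exists_frame_coeff {p : M} (hp : p ∉ T.axis) (h0 : ∀ i j, dif (T.x i) p (T.m j p) = 0)
    (v : TangentSpace I4 p) : ∃ c : Fin 4 → ℝ, v = c 0 • T.m 0 p + c 1 • T.m 1 p
      + c 2 • T.cplx p (T.m 0 p) + c 3 • T.cplx p (T.m 1 p) := by
  have hfin : Module.finrank ℝ (TangentSpace I4 p) = 4 := finrank_euclideanSpace_fin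
  set b := basisOfLinearIndependentOfCardEqFinrank (T.linearIndependent_frame hp h0)
    (by simp [hfin]) with hb
  refine ⟨fun l => b.repr v l, ?_⟩
  conv_lhs => rw [← b.sum_repr v, Fin.sum_univ_four]
  simp only [hb, coe_basisOfLinearIndependentOfCardEqFinrank]
  rfl

/-- The Gram determinant is the Jacobian times the determinant of `dξ, dη` on `I m₁, I m₂`. -/
theorem jacobian_mul_ne_zero {p : M} (hp : p ∉ T.axis) {ξ η : M → ℝ} {u v : Fin 2 → ℝ}
    (hx : ∀ i, dif (T.x i) p = u i • dif ξ p + v i • dif η p) :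
    (u 0 * v 1 - u 1 * v 0) * (dif ξ p (T.cplx p (T.m 0 p)) * dif η p (T.cplx p (T.m 1 p))
      - dif ξ p (T.cplx p (T.m 1 p)) * dif η p (T.cplx p (T.m 0 p))) ≠ 0 := by
  have hG := T.gram_ne_zero hp
  have hg : ∀ i j, T.metric.inner p (T.m i p) (T.m j p) =
      -(u i * dif ξ p (T.cplx p (T.m j p)) + v i * dif η p (T.cplx p (T.m j p))) := by
    intro i j
    rw [← T.cplx_isometry, T.hamiltonian, hx]; rfl
  simp only [hg] at hG
  intro h; apply hG; linear_combination h

/-- Cramer's rule in the plane of `I m₁, I m₂`, where `dξ, dη` have nonzero determinant by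
`jacobian_mul_ne_zero`. -/
theorem exists_dual_vectors {p : M} (hp : p ∉ T.axis) {ξ η : M → ℝ} {u v : Fin 2 → ℝ}
    (hx : ∀ i, dif (T.x i) p = u i • dif ξ p + v i • dif η p) :
    ∃ e₁ e₂, dif ξ p e₁ = 1 ∧ dif ξ p e₂ = 0 ∧ dif η p e₁ = 0 ∧ dif η p e₂ = 1 := by
  have hD := right_ne_zero_of_mul (T.jacobian_mul_ne_zero hp hx)
  set D := dif ξ p (T.cplx p (T.m 0 p)) * dif η p (T.cplx p (T.m 1 p))
      - dif ξ p (T.cplx p (T.m 1 p)) * dif η p (T.cplx p (T.m 0 p)) with hDdef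
  refine ⟨D⁻¹ • (dif η p (T.cplx p (T.m 1 p)) • T.cplx p (T.m 0 p)
      - dif η p (T.cplx p (T.m 0 p)) • T.cplx p (T.m 1 p)),
    D⁻¹ • (dif ξ p (T.cplx p (T.m 0 p)) • T.cplx p (T.m 1 p)
      - dif ξ p (T.cplx p (T.m 1 p)) • T.cplx p (T.m 0 p)), ?_, ?_, ?_, ?_⟩ <;>
  simp only [map_smul, map_sub, smul_eq_mul]
  · rw [inv_mul_eq_one₀ hD, hDdef]; ring
  · ring
  · ring
  · rw [inv_mul_eq_one₀ hD]

theorem dif_x_m {U : Set M} {ξ η : M → ℝ} (ho : T.IsOrthogonalCoords U ξ η) {u v : Fin 2 → M → ℝ}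
    (hx : ∀ i, HasPartials U ξ η (T.x i) (u i) (v i)) {p : M} (hp : p ∈ U) (i j : Fin 2) :
    dif (T.x i) p (T.m j p) = 0 := by
  rw [hx i p hp, add_apply, smul_apply, smul_apply, ho.invariant_xi p hp, ho.invariant_eta p hp]
  simp

theorem IsSeparable.exists_bilinear {T : ToricKahlerSurface M} {U : Set M} (hU : IsOpen U)
    (hUc : IsConnected U) (hUaxis : Disjoint U T.axis) {ξ η : M → ℝ}
    (hsep : T.IsSeparable U ξ η) : ∃ k a b w : Fin 2 → ℝ, ∀ i, ∀ p ∈ U,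
      T.x i p = k i + a i * ξ p + b i * η p + w i * (ξ p * η p) := by
  choose u v hu hv hx hdu hdv using hsep.separable
  choose u' hu' using hdu
  choose v' hv' using hdv
  have hax : ∀ p ∈ U, p ∉ T.axis := fun p hp h => Set.disjoint_left.1 hUaxis hp h
  have at_ : ∀ {g : M → ℝ}, ContMDiffOn I4 𝓘(ℝ, ℝ) ∞ g U → ∀ p ∈ U,
      ContMDiffAt I4 𝓘(ℝ, ℝ) ∞ g p := fun hg p hp => hg.contMDiffAt (hU.mem_nhds hp)
  have key : ∀ i, ∃ k a b w : ℝ, ∀ p ∈ U,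
      T.x i p = k + a * ξ p + b * η p + w * (ξ p * η p) := by
    intro i
    refine exists_bilinear_of_partials (u' := u' i) (v' := v' i) hU hUc
      (fun p _ => T.x_smooth i p) (at_ hsep.smooth_xi)
      (at_ hsep.smooth_eta) (at_ (hu i)) (at_ (hv i))
      (fun p hp => T.exists_dual_vectors (hax p hp) fun i => hx i p hp) (fun p hp => ?_) (hx i)
      (fun p hp => ?_) (fun p hp => ?_)
    -- One of `I m₁, I m₂` is a field with `dη(X) ≠ 0` at `p`, since otherwise the second factor of
    -- the Gram determinant would vanish.
    · have hD := right_ne_zero_of_mul (T.jacobian_mul_ne_zero (hax p hp) fun i => hx i p hp)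
      by_contra! hcon
      have h0 := hcon _ fun q _ => T.smoothFieldAt_frame 2 q
      have h1 := hcon _ fun q _ => T.smoothFieldAt_frame 3 q
      apply hD
      have h0' : dif η p (T.cplx p (T.m 0 p)) = 0 := h0
      have h1' : dif η p (T.cplx p (T.m 1 p)) = 0 := h1
      rw [h0', h1']; ring
    · simpa using hu' i p hp
    · simpa using hv' i p hp
  choose k a b w h using key
  exact ⟨k, a, b, w, h⟩

end ToricKahlerSurface

section Algebra

variable {V : Type*} [AddCommGroup V] [Module ℝ V]

/-- Thus `dξ, dη, dψ, dφ` form a coframe, as is needed for a chart: `dψ, dφ` read off the components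
along `n₀, n₁`, and `dξ, dη` those along `J n₀, J n₁`, by a system with determinant a multiple of
`abS`. -/
theorem IsHamiltonianFrame.eq_zero {g : V →ₗ[ℝ] V →ₗ[ℝ] ℝ} {J : V →ₗ[ℝ] V} {n₀ n₁ : V}
    {dξ dη : V →ₗ[ℝ] ℝ} {α β₀ β₁ : ℝ} (h : IsHamiltonianFrame g J n₀ n₁ dξ dη α β₀ β₁)
    {dψ dφ : V →ₗ[ℝ] ℝ}
    (hψ₀ : dψ n₀ = 1) (hψ₁ : dψ n₁ = 0) (hψ₂ : dψ (J n₀) = 0) (hψ₃ : dψ (J n₁) = 0)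
    (hφ₀ : dφ n₀ = 0) (hφ₁ : dφ n₁ = 1) (hφ₂ : dφ (J n₀) = 0) (hφ₃ : dφ (J n₁) = 0) {v : V}
    (h0 : dξ v = 0) (h1 : dη v = 0) (h2 : dψ v = 0) (h3 : dφ v = 0) : v = 0 := by
  obtain ⟨a, b, ha, hb, e1, e2, e3, e4⟩ := h.exists_norms
  have hS := h.det_ne
  obtain ⟨c₀, c₁, c₂, c₃, rfl⟩ := h.span v
  simp only [map_add, map_smul, smul_eq_mul, h.xi₀, h.xi₁, h.eta₀, h.eta₁, e1, e2, e3, e4,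
    hψ₀, hψ₁, hψ₂, hψ₃, hφ₀, hφ₁, hφ₂, hφ₃, mul_zero, mul_one, add_zero, zero_add] at h0 h1 h2 h3
  have k0 : c₂ + c₃ * α = 0 :=
    (mul_eq_zero.1 (by linear_combination -h0 : a * (c₂ + c₃ * α) = 0)).resolve_left ha
  have k1 : c₂ * β₀ + c₃ * β₁ = 0 :=
    (mul_eq_zero.1 (by linear_combination -h1 : b * (c₂ * β₀ + c₃ * β₁) = 0)).resolve_left hb
  have k3 : c₃ = 0 := by
    refine (mul_eq_zero.1 (?_ : c₃ * (β₁ - α * β₀) = 0)).resolve_right hS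
    linear_combination k1 - β₀ * k0
  have k2 : c₂ = 0 := by rw [k3] at k0; linarith
  rw [h2, h3, k2, k3]; simp

end Algebra

/-! ### Killing fields adapted to `P, Q`, and angular coordinates -/

namespace ToricKahlerSurface

variable {M : Type*} [TopologicalSpace M] [ChartedSpace E4 M] [IsManifold I4 ∞ M]
variable (T : ToricKahlerSurface M)

/-- The constant combination of `m₁, m₂` with coefficients the `k`-th column of `B`. -/
def comb (B : Matrix (Fin 2) (Fin 2) ℝ) (k : Fin 2) (p : M) : TangentSpace I4 p :=
  B 0 k • T.m 0 p + B 1 k • T.m 1 p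

/-- The moment maps are affine in the potentials `P, Q` of class `c`, infinitesimally. -/
def HasMomentDif (U : Set M) (ξ η : M → ℝ) (c : SepClass) (A : Matrix (Fin 2) (Fin 2) ℝ) : Prop :=
  ∀ p ∈ U, ∀ i, dif (T.x i) p = A 0 i • (dif ξ p + c.coeffEtaPsi • dif η p)
    + A 1 i • (c.coeffXi (η p) • dif ξ p + c.coeffEtaPhi (ξ p) • dif η p)

variable {T}
variable {U : Set M} {ξ η : M → ℝ} {c : SepClass} {A : Matrix (Fin 2) (Fin 2) ℝ}

theorem HasMomentDif.hasPartials (h : T.HasMomentDif U ξ η c A) (i : Fin 2) :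
    HasPartials U ξ η (T.x i) (fun p => A 0 i + A 1 i * c.coeffXi (η p))
      (fun p => A 0 i * c.coeffEtaPsi + A 1 i * c.coeffEtaPhi (ξ p)) := by
  intro p hp
  rw [h p hp i]
  ext v
  simp only [add_apply, smul_apply, smul_eq_mul]
  ring

/-- The Jacobian is `det A · Σ`, and it does not vanish off the axis. -/
theorem HasMomentDif.Sig_ne_zero (h : T.HasMomentDif U ξ η c A) (hax : Disjoint U T.axis) {p : M}
    (hp : p ∈ U) : c.Sig (ξ p) (η p) ≠ 0 := by
  have := left_ne_zero_of_mul (T.jacobian_mul_ne_zero (Set.disjoint_left.1 hax hp)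
    fun i => h.hasPartials i p hp)
  intro h0
  apply this
  rw [c.Sig_eq] at h0
  linear_combination (A 0 0 * A 1 1 - A 0 1 * A 1 0) * h0

theorem inv_mul_entries (hA : A.det ≠ 0) (j i : Fin 2) :
    A⁻¹ j 0 * A 0 i + A⁻¹ j 1 * A 1 i = if j = i then 1 else 0 := by
  have := Matrix.nonsing_inv_mul A (isUnit_iff_ne_zero.2 hA)
  have := congrFun (congrFun this j) i
  rwa [Matrix.mul_apply, Fin.sum_univ_two, Matrix.one_apply] at this

theorem mul_inv_entries (hA : A.det ≠ 0) (k l : Fin 2) :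
    A k 0 * A⁻¹ 0 l + A k 1 * A⁻¹ 1 l = if k = l then 1 else 0 := by
  have := Matrix.mul_nonsing_inv A (isUnit_iff_ne_zero.2 hA)
  have := congrFun (congrFun this k) l
  rwa [Matrix.mul_apply, Fin.sum_univ_two, Matrix.one_apply] at this

theorem m_eq_comb (hA : A.det ≠ 0) (i : Fin 2) (p : M) :
    T.m i p = A 0 i • T.comb A⁻¹ 0 p + A 1 i • T.comb A⁻¹ 1 p := by
  have h0 := inv_mul_entries hA 0 i
  have h1 := inv_mul_entries hA 1 i
  have : A 0 i • T.comb A⁻¹ 0 p + A 1 i • T.comb A⁻¹ 1 p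
      = (A⁻¹ 0 0 * A 0 i + A⁻¹ 0 1 * A 1 i) • T.m 0 p
        + (A⁻¹ 1 0 * A 0 i + A⁻¹ 1 1 * A 1 i) • T.m 1 p := by
    simp only [comb]; module
  rw [this, h0, h1]
  fin_cases i <;> simp

/-- Since `dx_i = A₀ᵢ dP + A₁ᵢ dQ`, combining the `m i` with the columns of `A⁻¹` gives fields with
Hamiltonian covectors exactly `dP` and `dQ`. -/
theorem HasMomentDif.isHamiltonianFrame (h : T.HasMomentDif U ξ η c A)
    (hax : Disjoint U T.axis) (hA : A.det ≠ 0) (ho : T.IsOrthogonalCoords U ξ η) {p : M}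
    (hp : p ∈ U) :
    IsHamiltonianFrame (T.bilin p) (T.cplx p).toLinearMap (T.comb A⁻¹ 0 p) (T.comb A⁻¹ 1 p)
      (dif ξ p).toLinearMap (dif η p).toLinearMap (c.coeffXi (η p)) c.coeffEtaPsi
      (c.coeffEtaPhi (ξ p)) where
  symm := T.metric.symm p
  pos := T.metric.pos p
  cplx_sq := T.cplx_sq p
  isometry := T.cplx_isometry p
  span v := by
    obtain ⟨d, hd⟩ := T.exists_frame_coeff (Set.disjoint_left.1 hax hp)
      (T.dif_x_m ho h.hasPartials hp) v
    have e0 := congrArg (T.cplx p) (T.m_eq_comb hA 0 p)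
    have e1 := congrArg (T.cplx p) (T.m_eq_comb hA 1 p)
    rw [map_add, map_smul, map_smul] at e0 e1
    rw [e0, e1, T.m_eq_comb hA 0 p, T.m_eq_comb hA 1 p] at hd
    refine ⟨d 0 * A 0 0 + d 1 * A 0 1, d 0 * A 1 0 + d 1 * A 1 1, d 2 * A 0 0 + d 3 * A 0 1,
      d 2 * A 1 0 + d 3 * A 1 1, ?_⟩
    rw [hd]
    simp only [ContinuousLinearMap.coe_coe]
    module
  ham₀ v := by
    have e0 := mul_inv_entries hA 0 0
    have e1 := mul_inv_entries hA 1 0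
    simp only [bilin_apply, ContinuousLinearMap.coe_coe, comb, map_add, map_smul, add_apply,
      smul_apply, LinearMap.add_apply, LinearMap.smul_apply, smul_eq_mul, T.hamiltonian, h p hp]
    simp at e0 e1
    linear_combination (-(dif ξ p v) - c.coeffEtaPsi * dif η p v) * e0
      - (c.coeffXi (η p) * dif ξ p v + c.coeffEtaPhi (ξ p) * dif η p v) * e1
  ham₁ v := by
    have e0 := mul_inv_entries hA 0 1
    have e1 := mul_inv_entries hA 1 1
    simp only [bilin_apply, ContinuousLinearMap.coe_coe, comb, map_add, map_smul, add_apply,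
      smul_apply, LinearMap.add_apply, LinearMap.smul_apply, smul_eq_mul, T.hamiltonian, h p hp]
    simp at e0 e1
    linear_combination (-(dif ξ p v) - c.coeffEtaPsi * dif η p v) * e0
      - (c.coeffXi (η p) * dif ξ p v + c.coeffEtaPhi (ξ p) * dif η p v) * e1
  xi₀ := by simp [comb, ho.invariant_xi p hp]
  xi₁ := by simp [comb, ho.invariant_xi p hp]
  eta₀ := by simp [comb, ho.invariant_eta p hp]
  eta₁ := by simp [comb, ho.invariant_eta p hp]
  xi_ne h0 := ho.dxi_ne_zero p hp (ContinuousLinearMap.coe_injective h0)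
  eta_ne h0 := ho.deta_ne_zero p hp (ContinuousLinearMap.coe_injective h0)
  orth := ho.orthogonal p hp
  det_ne := by rw [← c.Sig_eq]; exact h.Sig_ne_zero hax hp

theorem apply_comb {p : M} (α : TangentSpace I4 p →L[ℝ] ℝ) (B : Matrix (Fin 2) (Fin 2) ℝ)
    (k : Fin 2) : α (T.comb B k p) = B 0 k * α (T.m 0 p) + B 1 k * α (T.m 1 p) := by
  simp [comb]

theorem apply_cplx_comb {p : M} (α : TangentSpace I4 p →L[ℝ] ℝ) (B : Matrix (Fin 2) (Fin 2) ℝ)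
    (k : Fin 2) : α (T.cplx p (T.comb B k p)) =
      B 0 k * α (T.cplx p (T.m 0 p)) + B 1 k * α (T.cplx p (T.m 1 p)) := by
  simp [comb]

theorem contMDiffAt_dif_cplx_comb {f : M → ℝ} {p : M}
    (hf : ∀ᶠ q in 𝓝 p, ContMDiffAt I4 𝓘(ℝ, ℝ) ∞ f q) (B : Matrix (Fin 2) (Fin 2) ℝ) (k : Fin 2) :
    ContMDiffAt I4 𝓘(ℝ, ℝ) ∞ (fun q => dif f q (T.cplx q (T.comb B k q))) p := by
  simp only [apply_cplx_comb]
  exact (contMDiffAt_const.mul (contMDiffAt_dif_apply hf (T.smoothFieldAt_frame 2 p))).add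
    (contMDiffAt_const.mul (contMDiffAt_dif_apply hf (T.smoothFieldAt_frame 3 p)))

theorem dif_linear_comb {f g : M → ℝ} {p : M} (r s : ℝ) (hf : ContMDiffAt I4 𝓘(ℝ, ℝ) ∞ f p)
    (hg : ContMDiffAt I4 𝓘(ℝ, ℝ) ∞ g p) (v : TangentSpace I4 p) :
    dif (fun q => r * f q + s * g q) p v = r * dif f p v + s * dif g p v := by
  rw [dif_add (f := fun q => r * f q) (g := fun q => s * g q) (contMDiffAt_const.mul hf)
    (contMDiffAt_const.mul hg), dif_const_mul _ hf, dif_const_mul _ hg]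
  simp

/-- Angular coordinates `ψ k`, dual to the combinations `comb A⁻¹ k` of the Killing fields, and
potentials `y k` of the forms dual to their images under the complex structure. -/
theorem exists_potentials (hU : IsOpen U) (hax : Disjoint U T.axis) (hA : A.det ≠ 0)
    (h0 : ∀ q ∈ U, ∀ i j, dif (T.x i) q (T.m j q) = 0) {p : M} (hp : p ∈ U) :
    ∃ V ⊆ U, IsOpen V ∧ p ∈ V ∧ ∃ ψ y : Fin 2 → M → ℝ, ∀ k, ∀ q ∈ V,
      ContMDiffAt I4 𝓘(ℝ, ℝ) ∞ (ψ k) q ∧ ContMDiffAt I4 𝓘(ℝ, ℝ) ∞ (y k) q ∧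
      (∀ i, dif (ψ k) q (T.m i q) = A k i) ∧
      ∀ l, dif (ψ k) q (T.comb A⁻¹ l q) = (if k = l then 1 else 0) ∧
        dif (ψ k) q (T.cplx q (T.comb A⁻¹ l q)) = 0 ∧
        dif (y k) q (T.comb A⁻¹ l q) = 0 ∧
        dif (y k) q (T.cplx q (T.comb A⁻¹ l q)) = if k = l then 1 else 0 := by
  obtain ⟨V, hVU, hV, hpV, t, ht⟩ := exists_coordinates_of_commuting_frame (X := T.frame) hU hp
    (fun l q _ => T.smoothFieldAt_frame l q) (fun k l q _ => T.mlieBracket_frame k l q)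
    (fun q hq => T.linearIndependent_frame (Set.disjoint_left.1 hax hq) (h0 q hq))
  have hs : ∀ k, ∀ q ∈ V, ContMDiffAt I4 𝓘(ℝ, ℝ) ∞ (t k) q := fun k q hq => (ht k q hq).1
  have v0 : ∀ k, ∀ q ∈ V, dif (t k) q (T.m 0 q) = if 0 = k then 1 else 0 :=
    fun k q hq => (ht k q hq).2 0
  have v1 : ∀ k, ∀ q ∈ V, dif (t k) q (T.m 1 q) = if 1 = k then 1 else 0 :=
    fun k q hq => (ht k q hq).2 1
  have v2 : ∀ k, ∀ q ∈ V, dif (t k) q (T.cplx q (T.m 0 q)) = if 2 = k then 1 else 0 :=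
    fun k q hq => (ht k q hq).2 2
  have v3 : ∀ k, ∀ q ∈ V, dif (t k) q (T.cplx q (T.m 1 q)) = if 3 = k then 1 else 0 :=
    fun k q hq => (ht k q hq).2 3
  -- The `t` are coordinates dual to the frame of the `m i` and `I m i`; the rows of `A` turn them
  -- into coordinates dual to the combinations taken with the columns of `A⁻¹`.
  refine ⟨V, hVU, hV, hpV, fun k q => A k 0 * t 0 q + A k 1 * t 1 q,
    fun k q => A k 0 * t 2 q + A k 1 * t 3 q, fun k q hq => ⟨?_, ?_, ?_, fun l => ?_⟩⟩
  · exact (contMDiffAt_const.mul (hs 0 q hq)).add (contMDiffAt_const.mul (hs 1 q hq))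
  · exact (contMDiffAt_const.mul (hs 2 q hq)).add (contMDiffAt_const.mul (hs 3 q hq))
  · intro i
    rw [dif_linear_comb _ _ (hs 0 q hq) (hs 1 q hq)]
    match i with
    | 0 => rw [v0 0 q hq, v0 1 q hq]; simp
    | 1 => rw [v1 0 q hq, v1 1 q hq]; simp
  · have e := mul_inv_entries hA k l
    refine ⟨?_, ?_, ?_, ?_⟩
    · rw [apply_comb, dif_linear_comb _ _ (hs 0 q hq) (hs 1 q hq),
        dif_linear_comb _ _ (hs 0 q hq) (hs 1 q hq), v0 0 q hq, v0 1 q hq, v1 0 q hq, v1 1 q hq,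
        ← e]
      simp; ring
    · rw [apply_cplx_comb, dif_linear_comb _ _ (hs 0 q hq) (hs 1 q hq),
        dif_linear_comb _ _ (hs 0 q hq) (hs 1 q hq), v2 0 q hq, v2 1 q hq, v3 0 q hq, v3 1 q hq]
      simp
    · rw [apply_comb, dif_linear_comb _ _ (hs 2 q hq) (hs 3 q hq),
        dif_linear_comb _ _ (hs 2 q hq) (hs 3 q hq), v0 2 q hq, v0 3 q hq, v1 2 q hq, v1 3 q hq]
      simp
    · rw [apply_cplx_comb, dif_linear_comb _ _ (hs 2 q hq) (hs 3 q hq),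
        dif_linear_comb _ _ (hs 2 q hq) (hs 3 q hq), v2 2 q hq, v2 3 q hq, v3 2 q hq, v3 3 q hq,
        ← e]
      simp; ring

end ToricKahlerSurface

/-! ### The profile functions and the normal chart -/

namespace ToricKahlerSurface

variable {M : Type*} [TopologicalSpace M] [ChartedSpace E4 M] [IsManifold I4 ∞ M]
variable (T : ToricKahlerSurface M)

/-- The function `Σ |dξ|²`, which turns out to be the profile `F(ξ)`. -/
def profileXi (ξ : M → ℝ) (c : SepClass) (A : Matrix (Fin 2) (Fin 2) ℝ) (q : M) : ℝ :=
  c.coeffEtaPsi * dif ξ q (T.cplx q (T.comb A⁻¹ 1 q))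
    - c.coeffEtaPhi (ξ q) * dif ξ q (T.cplx q (T.comb A⁻¹ 0 q))

/-- The function `Σ |dη|²`, which turns out to be the profile `G(η)`. -/
def profileEta (η : M → ℝ) (c : SepClass) (A : Matrix (Fin 2) (Fin 2) ℝ) (q : M) : ℝ :=
  c.coeffXi (η q) * dif η q (T.cplx q (T.comb A⁻¹ 0 q)) - dif η q (T.cplx q (T.comb A⁻¹ 1 q))

variable {T}
variable {U : Set M} {ξ η : M → ℝ} {c : SepClass} {A : Matrix (Fin 2) (Fin 2) ℝ}

theorem contMDiffAt_profileXi {p : M} (hξ : ∀ᶠ q in 𝓝 p, ContMDiffAt I4 𝓘(ℝ, ℝ) ∞ ξ q) :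
    ContMDiffAt I4 𝓘(ℝ, ℝ) ∞ (T.profileXi ξ c A) p :=
  (contMDiffAt_const.mul (contMDiffAt_dif_cplx_comb hξ A⁻¹ 1)).sub
    ((c.contMDiffAt_coeffEtaPhi hξ.self_of_nhds).mul (contMDiffAt_dif_cplx_comb hξ A⁻¹ 0))

theorem contMDiffAt_profileEta {p : M} (hη : ∀ᶠ q in 𝓝 p, ContMDiffAt I4 𝓘(ℝ, ℝ) ∞ η q) :
    ContMDiffAt I4 𝓘(ℝ, ℝ) ∞ (T.profileEta η c A) p :=
  ((c.contMDiffAt_coeffXi hη.self_of_nhds).mul (contMDiffAt_dif_cplx_comb hη A⁻¹ 0)).sub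
    (contMDiffAt_dif_cplx_comb hη A⁻¹ 1)

theorem IsOrthogonalCoords.contMDiffAt_xi (ho : T.IsOrthogonalCoords U ξ η) (hU : IsOpen U) {p : M}
    (hp : p ∈ U) : ContMDiffAt I4 𝓘(ℝ, ℝ) ∞ ξ p := ho.smooth_xi.contMDiffAt (hU.mem_nhds hp)

theorem IsOrthogonalCoords.contMDiffAt_eta (ho : T.IsOrthogonalCoords U ξ η) (hU : IsOpen U) {p : M}
    (hp : p ∈ U) : ContMDiffAt I4 𝓘(ℝ, ℝ) ∞ η p := ho.smooth_eta.contMDiffAt (hU.mem_nhds hp)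

theorem IsOrthogonalCoords.eventually_xi (ho : T.IsOrthogonalCoords U ξ η) (hU : IsOpen U) {p : M}
    (hp : p ∈ U) : ∀ᶠ q in 𝓝 p, ContMDiffAt I4 𝓘(ℝ, ℝ) ∞ ξ q := by
  filter_upwards [hU.mem_nhds hp] with q hq using ho.contMDiffAt_xi hU hq

theorem IsOrthogonalCoords.eventually_eta (ho : T.IsOrthogonalCoords U ξ η) (hU : IsOpen U) {p : M}
    (hp : p ∈ U) : ∀ᶠ q in 𝓝 p, ContMDiffAt I4 𝓘(ℝ, ℝ) ∞ η q := by
  filter_upwards [hU.mem_nhds hp] with q hq using ho.contMDiffAt_eta hU hq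

theorem eq_zero_of_wedge_eq_zero {p : M} {α β : TangentSpace I4 p →L[ℝ] ℝ} (hβ : β ≠ 0)
    (h : ∀ a b, wedge α β a b = 0) {v : TangentSpace I4 p} (hv : β v = 0) : α v = 0 := by
  obtain ⟨w, hw⟩ : ∃ w, β w ≠ 0 := by
    by_contra! h0
    exact hβ (ContinuousLinearMap.ext h0)
  have := h v w
  rw [wedge, hv, mul_zero, sub_zero] at this
  exact (mul_eq_zero.1 this).resolve_right hw

theorem HasMomentDif.profile_ne_zero (h : T.HasMomentDif U ξ η c A) (hax : Disjoint U T.axis)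
    (hA : A.det ≠ 0) (ho : T.IsOrthogonalCoords U ξ η) {p : M} (hp : p ∈ U) :
    T.profileXi ξ c A p ≠ 0 ∧ T.profileEta η c A p ≠ 0 :=
  (h.isHamiltonianFrame hax hA ho hp).profile_ne_zero

/-- This is where commutation of `I n₀, I n₁` enters: the covectors dual to them are exact, and
their closedness gives two linear equations for `d(1/F) ∧ dξ` and `d(1/G) ∧ dη` with determinant
`±Σ`. Derivatives of the coefficients drop out, as `β₁` depends on `ξ` and `α` on `η`. -/
theorem HasMomentDif.dif_inv_profile (h : T.HasMomentDif U ξ η c A) (hU : IsOpen U)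
    (hax : Disjoint U T.axis) (hA : A.det ≠ 0) (ho : T.IsOrthogonalCoords U ξ η) {p : M}
    (hp : p ∈ U) :
    (∀ v, dif ξ p v = 0 → dif (fun q => (T.profileXi ξ c A q)⁻¹) p v = 0) ∧
    (∀ v, dif η p v = 0 → dif (fun q => (T.profileEta η c A q)⁻¹) p v = 0) := by
  obtain ⟨V, hVU, hV, hpV, ψ, y, hψy⟩ := exists_potentials hU hax hA
    (fun q hq => T.dif_x_m ho h.hasPartials hq) hp
  obtain ⟨hF0, hG0⟩ := h.profile_ne_zero hax hA ho hp
  set f : M → ℝ := fun q => (T.profileXi ξ c A q)⁻¹ with hf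
  set g : M → ℝ := fun q => (T.profileEta η c A q)⁻¹ with hg
  have hfs : ContMDiffAt I4 𝓘(ℝ, ℝ) ∞ f p :=
    (contMDiffAt_profileXi (ho.eventually_xi hU hp)).inv₀ hF0
  have hgs : ContMDiffAt I4 𝓘(ℝ, ℝ) ∞ g p :=
    (contMDiffAt_profileEta (ho.eventually_eta hU hp)).inv₀ hG0
  have hξ := ho.contMDiffAt_xi hU hp
  have hη := ho.contMDiffAt_eta hU hp
  have hdy : ∀ q ∈ V, ∀ v,
      dif (y 0) q v = -(c.coeffEtaPhi (ξ q) * f q) * dif ξ q v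
        + c.coeffXi (η q) * g q * dif η q v ∧
      dif (y 1) q v = c.coeffEtaPsi * f q * dif ξ q v + -g q * dif η q v := by
    intro q hq v
    have e := fun k l => (hψy k q hq).2.2.2 l
    exact (h.isHamiltonianFrame hax hA ho (hVU hq)).dual_covectors_eq
      (y₀ := (dif (y 0) q).toLinearMap) (y₁ := (dif (y 1) q).toLinearMap)
      (e 0 0).2.2.1 (e 0 1).2.2.1 (by simpa using (e 0 0).2.2.2) (by simpa using (e 0 1).2.2.2)
      (e 1 0).2.2.1 (e 1 1).2.2.1 (by simpa using (e 1 0).2.2.2) (by simpa using (e 1 1).2.2.2)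
      rfl rfl v
  have ys : ∀ k, ∀ᶠ q in 𝓝 p, ContMDiffAt I4 𝓘(ℝ, ℝ) ∞ (y k) q := fun k => by
    filter_upwards [hV.mem_nhds hpV] with q hq using (hψy k q hq).2.1
  have b₁ := c.contMDiffAt_coeffEtaPhi hξ
  have a₁ := c.contMDiffAt_coeffXi hη
  have sb : ContMDiffAt I4 𝓘(ℝ, ℝ) ∞ (fun q => c.coeffEtaPhi (ξ q) * f q) p := b₁.mul hfs
  have sa : ContMDiffAt I4 𝓘(ℝ, ℝ) ∞ (fun q => c.coeffXi (η q) * g q) p := a₁.mul hgs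
  have w₀ := fun v w => wedge_add_wedge_eq_zero (f := y 0)
    (u := fun q => -1 * (c.coeffEtaPhi (ξ q) * f q)) (v := fun q => c.coeffXi (η q) * g q)
    (ys 0) (contMDiffAt_const.mul sb) sa (ho.eventually_xi hU hp) (ho.eventually_eta hU hp)
    (by
      filter_upwards [hV.mem_nhds hpV] with q hq
      ext v
      rw [(hdy q hq v).1]
      simp) v w
  have w₁ := fun v w => wedge_add_wedge_eq_zero (f := y 1)
    (u := fun q => c.coeffEtaPsi * f q) (v := fun q => -1 * g q)
    (ys 1) (contMDiffAt_const.mul hfs) (contMDiffAt_const.mul hgs)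
    (ho.eventually_xi hU hp) (ho.eventually_eta hU hp)
    (by
      filter_upwards [hV.mem_nhds hpV] with q hq
      ext v
      rw [(hdy q hq v).2]
      simp) v w
  rw [dif_const_mul _ sb, dif_mul b₁ hfs, dif_mul a₁ hgs, c.dif_coeffEtaPhi, c.dif_coeffXi] at w₀
  rw [dif_const_mul _ hfs, dif_const_mul _ hgs] at w₁
  simp only [wedge, add_apply, smul_apply, smul_eq_mul] at w₀ w₁
  have hS : c.coeffEtaPhi (ξ p) - c.coeffXi (η p) * c.coeffEtaPsi ≠ 0 := by
    rw [← c.Sig_eq]; exact h.Sig_ne_zero hax hp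
  -- Adding `α` times the second closedness equation to the first eliminates `dg ∧ dη`.
  have W₁ : ∀ v w, wedge (dif f p) (dif ξ p) v w = 0 := by
    intro v w
    refine (mul_eq_zero.1 (?_ : (c.coeffEtaPhi (ξ p) - c.coeffXi (η p) * c.coeffEtaPsi)
      * wedge (dif f p) (dif ξ p) v w = 0)).resolve_left hS
    rw [wedge]
    linear_combination -(w₀ v w) - c.coeffXi (η p) * w₁ v w
  have W₂ : ∀ v w, wedge (dif g p) (dif η p) v w = 0 := by
    intro v w
    have := W₁ v w
    rw [wedge] at this ⊢
    linear_combination -(w₁ v w) + c.coeffEtaPsi * this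
  exact ⟨fun v => eq_zero_of_wedge_eq_zero (ho.dxi_ne_zero p hp) W₁,
    fun v => eq_zero_of_wedge_eq_zero (ho.deta_ne_zero p hp) W₂⟩

/-- The chart is `(ξ, η, ψ 0, ψ 1)` with target a ball, so that `dif_inv_profile` makes the
reciprocal profiles functions of one coordinate each. The rest is the pointwise algebra. -/
theorem HasMomentDif.exists_normal_chart (h : T.HasMomentDif U ξ η c A) (hU : IsOpen U)
    (hax : Disjoint U T.axis) (hA : A.det ≠ 0) (ho : T.IsOrthogonalCoords U ξ η) {p : M}
    (hp : p ∈ U) :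
    ∃ e ∈ IsManifold.maximalAtlas I4 ∞ M, p ∈ e.source ∧ e.source ⊆ U ∧
      (∀ q ∈ e.source, e q 0 = ξ q ∧ e q 1 = η q) ∧
      ∃ F G : ℝ → ℝ, ∀ q ∈ e.source,
        T.NormalFormAt c A F G ξ η (fun q => e q 2) (fun q => e q 3) q := by
  obtain ⟨V, hVU, hV, hpV, ψ, y, hψy⟩ := exists_potentials hU hax hA
    (fun q hq => T.dif_x_m ho h.hasPartials hq) hp
  have hfr := fun q hq => h.isHamiltonianFrame hax hA ho (hVU hq) (p := q)
  have d := fun k l q hq => (hψy k q hq).2.2.2 l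
  obtain ⟨e, he, hpe, hesub, hef, r, -, hr⟩ := exists_chart_of_independent_dif hV hpV
    (f := ![ξ, η, ψ 0, ψ 1])
    (fun k q hq => by
      match k with
      | 0 => exact ho.contMDiffAt_xi hU (hVU hq)
      | 1 => exact ho.contMDiffAt_eta hU (hVU hq)
      | 2 => exact (hψy 0 q hq).1
      | 3 => exact (hψy 1 q hq).1)
    (fun q hq v hv =>
      (hfr q hq).eq_zero (dψ := (dif (ψ 0) q).toLinearMap) (dφ := (dif (ψ 1) q).toLinearMap)
        (by simpa using (d 0 0 q hq).1) (by simpa using (d 0 1 q hq).1)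
        (d 0 0 q hq).2.1 (d 0 1 q hq).2.1
        (by simpa using (d 1 0 q hq).1) (by simpa using (d 1 1 q hq).1)
        (d 1 0 q hq).2.1 (d 1 1 q hq).2.1 (hv 0) (hv 1) (hv 2) (hv 3))
  have hdif : ∀ k, ∀ q ∈ e.source, dif (fun z => e z k) q = dif ((![ξ, η, ψ 0, ψ 1] : Fin 4 → M → ℝ) k) q :=
    fun k q hq => dif_congr <| by
      filter_upwards [e.open_source.mem_nhds hq] with z hz using hef z hz k
  have hne := fun q hq => h.profile_ne_zero hax hA ho (hVU (hesub hq)) (p := q)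
  obtain ⟨f, hf⟩ := exists_eq_comp_coordinate he hr (f := fun q => (T.profileXi ξ c A q)⁻¹)
    (fun q hq => (contMDiffAt_profileXi (ho.eventually_xi hU (hVU (hesub hq)))).inv₀ (hne q hq).1) 0
    (fun q hq v hv => (h.dif_inv_profile hU hax hA ho (hVU (hesub hq))).1 v
      (by rwa [hdif 0 q hq] at hv))
  obtain ⟨g, hg⟩ := exists_eq_comp_coordinate he hr (f := fun q => (T.profileEta η c A q)⁻¹)
    (fun q hq => (contMDiffAt_profileEta (ho.eventually_eta hU (hVU (hesub hq)))).inv₀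
      (hne q hq).2) 1
    (fun q hq v hv => (h.dif_inv_profile hU hax hA ho (hVU (hesub hq))).2 v
      (by rwa [hdif 1 q hq] at hv))
  have he0 : ∀ q ∈ e.source, e q 0 = ξ q := fun q hq => hef q hq 0
  have he1 : ∀ q ∈ e.source, e q 1 = η q := fun q hq => hef q hq 1
  refine ⟨e, he, hpe, hesub.trans hVU, fun q hq => ⟨he0 q hq, he1 q hq⟩,
    fun s => (f s)⁻¹, fun s => (g s)⁻¹, fun q hq => ?_⟩
  have hqV := hesub hq
  have hqU := hVU hqV
  obtain ⟨hfq, hfs⟩ := hf q hq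
  obtain ⟨hgq, hgs⟩ := hg q hq
  rw [he0 q hq] at hfq hfs
  rw [he1 q hq] at hgq hgs
  have hFq : (f (ξ q))⁻¹ = T.profileXi ξ c A q := by rw [← hfq, inv_inv]
  have hGq : (g (η q))⁻¹ = T.profileEta η c A q := by rw [← hgq, inv_inv]
  have hξ := ho.contMDiffAt_xi hU hqU
  have hη := ho.contMDiffAt_eta hU hqU
  have h2 : dif (fun z => e z 2) q = dif (ψ 0) q := hdif 2 q hq
  have h3 : dif (fun z => e z 3) q = dif (ψ 1) q := hdif 3 q hq
  exact
    { smooth_F := hfs.inv (by rw [← hfq]; exact inv_ne_zero (hne q hq).1)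
      smooth_G := hgs.inv (by rw [← hgq]; exact inv_ne_zero (hne q hq).2)
      Sig_ne_zero := h.Sig_ne_zero hax hqU
      F_ne_zero := by rw [hFq]; exact (hne q hq).1
      G_ne_zero := by rw [hGq]; exact (hne q hq).2
      metric_eq := fun v w => by
        rw [h2, h3, hFq, hGq, c.sigXi_eq, c.sigEta_eq]
        exact (hfr q hqV).metric_eq
          (dψ := (dif (ψ 0) q).toLinearMap) (dφ := (dif (ψ 1) q).toLinearMap)
          (by simpa using (d 0 0 q hqV).1) (by simpa using (d 0 1 q hqV).1)
          (d 0 0 q hqV).2.1 (d 0 1 q hqV).2.1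
          (by simpa using (d 1 0 q hqV).1) (by simpa using (d 1 1 q hqV).1)
          (d 1 0 q hqV).2.1 (d 1 1 q hqV).2.1 rfl rfl (c.Sig_eq _ _) v w
      form_eq := fun v w => by
        rw [h2, h3, c.dif_P hξ hη, c.dif_Q hξ hη]
        exact (hfr q hqV).form_eq
          (dψ := (dif (ψ 0) q).toLinearMap) (dφ := (dif (ψ 1) q).toLinearMap)
          (by simpa using (d 0 0 q hqV).1) (by simpa using (d 0 1 q hqV).1)
          (d 0 0 q hqV).2.1 (d 0 1 q hqV).2.1
          (by simpa using (d 1 0 q hqV).1) (by simpa using (d 1 1 q hqV).1)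
          (d 1 0 q hqV).2.1 (d 1 1 q hqV).2.1 v w
      killing_xi := ho.invariant_xi q hqU
      killing_eta := ho.invariant_eta q hqU
      killing_psi := fun i => by rw [h2]; exact (hψy 0 q hqV).2.2.1 i
      killing_phi := fun i => by rw [h3]; exact (hψy 1 q hqV).2.2.1 i }

end ToricKahlerSurface

/-! ### Affine changes, the trichotomy and the three reductions -/

namespace ToricKahlerSurface

variable {M : Type*} [TopologicalSpace M] [ChartedSpace E4 M] [IsManifold I4 ∞ M]
variable {T : ToricKahlerSurface M} {U : Set M} {ξ η : M → ℝ}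

theorem exists_metric_dual (p : M) (α : TangentSpace I4 p →L[ℝ] ℝ) :
    ∃ v, ∀ w, T.metric.inner p v w = α w := by
  have : FiniteDimensional ℝ (TangentSpace I4 p) := inferInstanceAs (FiniteDimensional ℝ E4)
  have hinj : Function.Injective (T.bilin p) := by
    rw [injective_iff_map_eq_zero]
    intro v hv
    by_contra h0
    have h1 : T.metric.inner p v v = 0 := DFunLike.congr_fun hv v
    exact (T.metric.pos p v h0).ne' h1
  have hsurj := (LinearMap.injective_iff_surjective_of_finrank_eq_finrank
    (Subspace.dual_finrank_eq (K := ℝ) (V := TangentSpace I4 p)).symm).1 hinj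
  obtain ⟨v, hv⟩ := hsurj α.toLinearMap
  exact ⟨v, fun w => DFunLike.congr_fun hv w⟩

theorem IsOrthogonalCoords.symm (ho : T.IsOrthogonalCoords U ξ η) :
    T.IsOrthogonalCoords U η ξ where
  smooth_xi := ho.smooth_eta
  smooth_eta := ho.smooth_xi
  invariant_xi := ho.invariant_eta
  invariant_eta := ho.invariant_xi
  dxi_ne_zero := ho.deta_ne_zero
  deta_ne_zero := ho.dxi_ne_zero
  orthogonal p hp := by
    obtain ⟨u, hu, hu0⟩ := ho.orthogonal p hp
    obtain ⟨v, hv⟩ := T.exists_metric_dual p (dif η p)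
    exact ⟨v, hv, by rw [← hu, T.metric.symm, hv, hu0]⟩

theorem IsOrthogonalCoords.affine (ho : T.IsOrthogonalCoords U ξ η) (hU : IsOpen U)
    {K₁ K₂ : ℝ} (hK₁ : K₁ ≠ 0) (hK₂ : K₂ ≠ 0) (C₁ C₂ : ℝ) :
    T.IsOrthogonalCoords U (fun p => K₁ * ξ p + C₁) (fun p => K₂ * η p + C₂) := by
  have d₁ : ∀ p ∈ U, dif (fun p => K₁ * ξ p + C₁) p = K₁ • dif ξ p := fun p hp =>
    dif_mul_add_const _ _ (ho.contMDiffAt_xi hU hp)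
  have d₂ : ∀ p ∈ U, dif (fun p => K₂ * η p + C₂) p = K₂ • dif η p := fun p hp =>
    dif_mul_add_const _ _ (ho.contMDiffAt_eta hU hp)
  refine ⟨(contMDiffOn_const.mul ho.smooth_xi).add contMDiffOn_const,
    (contMDiffOn_const.mul ho.smooth_eta).add contMDiffOn_const, fun p hp i => ?_,
    fun p hp i => ?_, fun p hp => ?_, fun p hp => ?_, fun p hp => ?_⟩
  · simp [d₁ p hp, ho.invariant_xi p hp]
  · simp [d₂ p hp, ho.invariant_eta p hp]
  · rw [d₁ p hp]; exact smul_ne_zero hK₁ (ho.dxi_ne_zero p hp)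
  · rw [d₂ p hp]; exact smul_ne_zero hK₂ (ho.deta_ne_zero p hp)
  · obtain ⟨u, hu, hu0⟩ := ho.orthogonal p hp
    refine ⟨K₁ • u, fun w => ?_, ?_⟩
    · simp [d₁ p hp, hu]
    · simp [d₂ p hp, hu0]

theorem hasMomentDif_of_eq (hU : IsOpen U) (ho : T.IsOrthogonalCoords U ξ η) {c : SepClass}
    {A : Matrix (Fin 2) (Fin 2) ℝ} {k : Fin 2 → ℝ}
    (hx : ∀ p ∈ U, ∀ i, T.x i p = k i + A 0 i * c.P (ξ p) (η p) + A 1 i * c.Q (ξ p) (η p)) :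
    T.HasMomentDif U ξ η c A := by
  intro p hp i
  have hξ := ho.contMDiffAt_xi hU hp
  have hη := ho.contMDiffAt_eta hU hp
  have hP := c.contMDiffAt_P hξ hη
  have hQ := c.contMDiffAt_Q hξ hη
  have hP' : ContMDiffAt I4 𝓘(ℝ, ℝ) ∞ (fun q => A 0 i * c.P (ξ q) (η q)) p :=
    contMDiffAt_const.mul hP
  have hQ' : ContMDiffAt I4 𝓘(ℝ, ℝ) ∞ (fun q => A 1 i * c.Q (ξ q) (η q)) p :=
    contMDiffAt_const.mul hQ
  have hkP : ContMDiffAt I4 𝓘(ℝ, ℝ) ∞ (fun q => k i + A 0 i * c.P (ξ q) (η q)) p :=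
    contMDiffAt_const.add hP'
  have e : dif (T.x i) p = dif (fun q => k i + A 0 i * c.P (ξ q) (η q)
      + A 1 i * c.Q (ξ q) (η q)) p := dif_congr <| by
    filter_upwards [hU.mem_nhds hp] with q hq using hx q hq i
  rw [e, dif_add hkP hQ', dif_add contMDiffAt_const hP', dif_const, zero_add, dif_const_mul _ hP,
    dif_const_mul _ hQ, c.dif_P hξ hη, c.dif_Q hξ hη]

theorem hasNormalForm_of_eq (hU : IsOpen U) (hax : Disjoint U T.axis) {ξ' η' : M → ℝ}
    (hch : IsAffineChange ξ η ξ' η') (ho : T.IsOrthogonalCoords U ξ' η') {c : SepClass}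
    {A : Matrix (Fin 2) (Fin 2) ℝ} (hA : A.det ≠ 0) {k : Fin 2 → ℝ}
    (hx : ∀ p ∈ U, ∀ i, T.x i p = k i + A 0 i * c.P (ξ' p) (η' p) + A 1 i * c.Q (ξ' p) (η' p)) :
    T.HasNormalForm U ξ η c := by
  have h := hasMomentDif_of_eq hU ho hx
  refine ⟨ξ', η', A, k, hch, hA, hx, ⟨A.det, hA, _, _, h.hasPartials, fun p hp => ?_⟩,
    fun p hp => h.exists_normal_chart hU hax hA ho hp⟩
  simp only [c.Sig_eq, Matrix.det_fin_two]
  ring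

/-- The class of `(Ω_ξ, Ω_η)` for constant `Ω_ξ, Ω_η`. -/
def IsClassOfSlopes (X Y : ℝ) : SepClass → Prop
  | SepClass.PT => X = 0 ∧ Y = 0
  | SepClass.CT => (X ≠ 0 ∧ Y = 0) ∨ (X = 0 ∧ Y ≠ 0)
  | SepClass.OT => X ≠ 0 ∧ Y ≠ 0

theorem existsUnique_isClassOfSlopes (X Y : ℝ) : ∃! c, IsClassOfSlopes X Y c := by
  by_cases hX : X = 0 <;> by_cases hY : Y = 0
  · exact ⟨.PT, ⟨hX, hY⟩, fun c hc => by cases c <;> simp_all [IsClassOfSlopes]⟩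
  · exact ⟨.CT, Or.inr ⟨hX, hY⟩, fun c hc => by cases c <;> simp_all [IsClassOfSlopes]⟩
  · exact ⟨.CT, Or.inl ⟨hX, hY⟩, fun c hc => by cases c <;> simp_all [IsClassOfSlopes]⟩
  · exact ⟨.OT, ⟨hX, hY⟩, fun c hc => by cases c <;> simp_all [IsClassOfSlopes]⟩

section Slopes

variable {k a b w : Fin 2 → ℝ}

theorem hasPartials_of_bilinear (hU : IsOpen U) (ho : T.IsOrthogonalCoords U ξ η)
    (hx : ∀ i, ∀ p ∈ U, T.x i p = k i + a i * ξ p + b i * η p + w i * (ξ p * η p)) (i : Fin 2) :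
    HasPartials U ξ η (T.x i) (fun p => a i + w i * η p) (fun p => b i + w i * ξ p) := by
  intro p hp
  rw [← dif_bilinear (k i) _ _ _ (ho.contMDiffAt_xi hU hp) (ho.contMDiffAt_eta hU hp)]
  refine dif_congr ?_
  filter_upwards [hU.mem_nhds hp] with q hq using hx i q hq

/-- The Jacobian of the bilinear moment maps is affine, `Z + Xξ + Yη`: its quadratic terms `w_i w_j
ξη` cancel. So its partial derivatives are constant, and vanishing at one point is the same as
vanishing identically. -/
theorem isOfClass_iff (hU : IsOpen U) (hUc : IsConnected U) (hax : Disjoint U T.axis)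
    (ho : T.IsOrthogonalCoords U ξ η)
    (hx : ∀ i, ∀ p ∈ U, T.x i p = k i + a i * ξ p + b i * η p + w i * (ξ p * η p))
    (c : SepClass) :
    T.IsOfClass U ξ η c ↔ IsClassOfSlopes (a 0 * w 1 - a 1 * w 0) (w 0 * b 1 - w 1 * b 0) c := by
  have hpar := hasPartials_of_bilinear hU ho hx
  set X := a 0 * w 1 - a 1 * w 0 with hX
  set Y := w 0 * b 1 - w 1 * b 0 with hY
  set Z := a 0 * b 1 - a 1 * b 0 with hZ
  have hdΩ : ∀ p ∈ U, dif (fun q => Z + X * ξ q + Y * η q + 0 * (ξ q * η q)) p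
      = X • dif ξ p + Y • dif η p := fun p hp => by
    rw [dif_bilinear _ _ _ _ (ho.contMDiffAt_xi hU hp) (ho.contMDiffAt_eta hU hp)]
    simp
  constructor
  · rintro ⟨Ω, Ωξ, Ωη, -, ⟨u, v, huv, hΩ⟩, hd, hc⟩
    -- Partial derivatives are unique because `dξ, dη` are independent; hence the class does not
    -- depend on the witnesses in `IsOfClass`.
    have huniq : ∀ p ∈ U, ∀ {r s r' s' : ℝ},
        r • dif ξ p + s • dif η p = r' • dif ξ p + s' • dif η p → r = r' ∧ s = s' := by
      intro p hp r s r' s' h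
      obtain ⟨e₁, e₂, h1, h2, h3, h4⟩ := T.exists_dual_vectors (Set.disjoint_left.1 hax hp)
        fun i => hpar i p hp
      constructor
      · simpa [h1, h3] using DFunLike.congr_fun h e₁
      · simpa [h2, h4] using DFunLike.congr_fun h e₂
    have hΩ' : ∀ p ∈ U, Ω p = Z + X * ξ p + Y * η p + 0 * (ξ p * η p) := by
      intro p hp
      have e := fun i => huniq p hp ((huv i p hp).symm.trans (hpar i p hp))
      rw [hΩ p hp, (e 0).1, (e 0).2, (e 1).1, (e 1).2, hX, hY, hZ]
      ring
    have hslopes : ∀ p ∈ U, Ωξ p = X ∧ Ωη p = Y := by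
      intro p hp
      refine huniq p hp ?_
      rw [← hd p hp, ← hdΩ p hp]
      refine dif_congr ?_
      filter_upwards [hU.mem_nhds hp] with q hq using hΩ' q hq
    obtain ⟨p, hp⟩ := hUc.nonempty
    obtain ⟨h1, h2⟩ := hslopes p hp
    cases c
    · have := hc p hp
      rwa [h1, h2] at this
    · rcases hc with hc | hc
      · have := hc p hp
        rw [h1, h2] at this
        exact Or.inl this
      · have := hc p hp
        rw [h1, h2] at this
        exact Or.inr this
    · have := hc p hp
      rwa [h1, h2] at this
  · intro hc
    refine ⟨fun q => Z + X * ξ q + Y * η q + 0 * (ξ q * η q), fun _ => X, fun _ => Y,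
      fun p hp => (contMDiffAt_bilinear _ _ _ _ (ho.contMDiffAt_xi hU hp)
        (ho.contMDiffAt_eta hU hp)).contMDiffWithinAt,
      ⟨_, _, hpar, fun p hp => ?_⟩, hdΩ, ?_⟩
    · rw [hX, hY, hZ]
      ring
    · cases c
      · exact fun p _ => hc
      · exact hc.imp (fun h p _ => h) (fun h p _ => h)
      · exact fun p _ => hc

/-- Here `Ω` is the constant `Z`, so `Z ≠ 0`, and `Z w = X b + Y a = 0` forces `w = 0`. -/
theorem hasNormalForm_PT (hU : IsOpen U) (hUc : IsConnected U) (hax : Disjoint U T.axis)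
    (ho : T.IsOrthogonalCoords U ξ η)
    (hx : ∀ i, ∀ p ∈ U, T.x i p = k i + a i * ξ p + b i * η p + w i * (ξ p * η p))
    (hX : a 0 * w 1 - a 1 * w 0 = 0) (hY : w 0 * b 1 - w 1 * b 0 = 0) :
    T.HasNormalForm U ξ η SepClass.PT := by
  have hpar := hasPartials_of_bilinear hU ho hx
  obtain ⟨p₀, hp₀⟩ := hUc.nonempty
  have hJ := left_ne_zero_of_mul (T.jacobian_mul_ne_zero (Set.disjoint_left.1 hax hp₀)
    fun i => hpar i p₀ hp₀)
  have hZ : a 0 * b 1 - a 1 * b 0 ≠ 0 := by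
    intro h0
    apply hJ
    linear_combination h0 + ξ p₀ * hX + η p₀ * hY
  have hw : ∀ i, w i = 0 := by
    intro i
    refine (mul_eq_zero.1 (?_ : w i * (a 0 * b 1 - a 1 * b 0) = 0)).resolve_right hZ
    match i with
    | 0 => linear_combination b 0 * hX + a 0 * hY
    | 1 => linear_combination b 1 * hX + a 1 * hY
  have ho' := ho.affine hU one_ne_zero one_ne_zero 0 0
  refine hasNormalForm_of_eq hU hax (A := !![a 0, a 1; b 0, b 1]) (k := k)
    ⟨1, 0, 1, 0, one_ne_zero, one_ne_zero, Or.inl fun p => ⟨rfl, rfl⟩⟩ ho' ?_ fun p hp i => ?_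
  · rwa [Matrix.det_fin_two_of]
  · rw [hx i p hp, hw i]
    fin_cases i <;> simp [SepClass.P, SepClass.Q]

/-- With `b = l w` one has `aξ + bη + wξη = a(ξ + l) + w(ξ + l)η - al`. The separate original pair
`ξ₀, η₀` allows the coordinates to have been exchanged beforehand. -/
theorem hasNormalForm_CT (hU : IsOpen U) (hax : Disjoint U T.axis) {ξ₀ η₀ : M → ℝ}
    (hch : ∀ l : ℝ, IsAffineChange ξ₀ η₀ (fun p => 1 * ξ p + l) (fun p => 1 * η p + 0))
    (ho : T.IsOrthogonalCoords U ξ η)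
    (hx : ∀ i, ∀ p ∈ U, T.x i p = k i + a i * ξ p + b i * η p + w i * (ξ p * η p))
    (hX : a 0 * w 1 - a 1 * w 0 ≠ 0) (hY : w 0 * b 1 - w 1 * b 0 = 0) :
    T.HasNormalForm U ξ₀ η₀ SepClass.CT := by
  obtain ⟨l, hl⟩ : ∃ l : ℝ, ∀ i, b i = l * w i := by
    -- Cramer's rule in the basis `a, w`: the coefficient of `w` in `b` is `Z/X`, and that of `a` is
    -- `-Y/X = 0`.
    refine ⟨(a 0 * b 1 - a 1 * b 0) / (a 0 * w 1 - a 1 * w 0), fun i => ?_⟩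
    rw [div_mul_eq_mul_div, eq_div_iff hX]
    match i with
    | 0 => linear_combination -(a 0 * hY)
    | 1 => linear_combination -(a 1 * hY)
  refine hasNormalForm_of_eq hU hax (A := !![a 0, a 1; w 0, w 1]) (k := fun i => k i - a i * l)
    (hch l) (ho.affine hU one_ne_zero one_ne_zero l 0) ?_ fun p hp i => ?_
  · rwa [Matrix.det_fin_two_of]
  · rw [hx i p hp, hl i]
    fin_cases i <;> simp [SepClass.P, SepClass.Q] <;> ring

/-- With `b = l w + r a`, `ξ' = ξ + l` and `η' = rη` one has `aξ + bη + wξη = a(ξ' + η') + (w/r)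
ξ'η' - al`. Cramer's rule gives `l = Z/X` and `r = -Y/X`, which is nonzero. -/
theorem hasNormalForm_OT (hU : IsOpen U) (hax : Disjoint U T.axis)
    (ho : T.IsOrthogonalCoords U ξ η)
    (hx : ∀ i, ∀ p ∈ U, T.x i p = k i + a i * ξ p + b i * η p + w i * (ξ p * η p))
    (hX : a 0 * w 1 - a 1 * w 0 ≠ 0) (hY : w 0 * b 1 - w 1 * b 0 ≠ 0) :
    T.HasNormalForm U ξ η SepClass.OT := by
  obtain ⟨l, r, hr, hlr⟩ : ∃ l r : ℝ, r ≠ 0 ∧ ∀ i, b i = l * w i + r * a i := by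
    refine ⟨(a 0 * b 1 - a 1 * b 0) / (a 0 * w 1 - a 1 * w 0),
      -(w 0 * b 1 - w 1 * b 0) / (a 0 * w 1 - a 1 * w 0),
      div_ne_zero (neg_ne_zero.2 hY) hX, fun i => ?_⟩
    rw [div_mul_eq_mul_div, div_mul_eq_mul_div, ← add_div, eq_div_iff hX]
    match i with
    | 0 => ring
    | 1 => ring
  refine hasNormalForm_of_eq hU hax (A := !![a 0, a 1; w 0 / r, w 1 / r])
    (k := fun i => k i - a i * l) (ξ' := fun p => 1 * ξ p + l) (η' := fun p => r * η p + 0)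
    ⟨1, l, r, 0, one_ne_zero, hr, Or.inl fun p => ⟨rfl, rfl⟩⟩
    (ho.affine hU one_ne_zero hr l 0) ?_ fun p hp i => ?_
  · rw [Matrix.det_fin_two_of]
    intro h0
    apply hX
    field_simp at h0
    rwa [mul_zero] at h0
  · rw [hx i p hp, hlr i]
    fin_cases i <;> simp [SepClass.P, SepClass.Q] <;> field_simp <;> ring

end Slopes

end ToricKahlerSurface

/-! ### The classification -/

theorem mainTheorem8 {M : Type*} [TopologicalSpace M] [ChartedSpace E4 M] [IsManifold I4 ∞ M]
    (T : ToricKahlerSurface M) (U : Set M) (hU : IsOpen U) (hUc : IsConnected U)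
    (hUaxis : Disjoint U T.axis) (ξ η : M → ℝ) (hsep : T.IsSeparable U ξ η) :
    (∃! c : SepClass, T.IsOfClass U ξ η c) ∧
      ∀ c : SepClass, T.IsOfClass U ξ η c → T.HasNormalForm U ξ η c := by
  obtain ⟨k, a, b, w, hx⟩ := hsep.exists_bilinear hU hUc hUaxis
  have ho := hsep.toIsOrthogonalCoords
  simp only [ToricKahlerSurface.isOfClass_iff hU hUc hUaxis ho hx]
  refine ⟨ToricKahlerSurface.existsUnique_isClassOfSlopes _ _, fun c hc => ?_⟩
  cases c
  · exact ToricKahlerSurface.hasNormalForm_PT hU hUc hUaxis ho hx hc.1 hc.2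
  · rcases hc with ⟨hX, hY⟩ | ⟨hX, hY⟩
    · exact ToricKahlerSurface.hasNormalForm_CT hU hUaxis
        (fun l => ⟨1, l, 1, 0, one_ne_zero, one_ne_zero, Or.inl fun p => ⟨rfl, rfl⟩⟩) ho hx hX hY
    -- Exchanging the coordinates exchanges `a` and `b`, which turns `(X, Y)` into `(-Y, -X)`.
    · refine ToricKahlerSurface.hasNormalForm_CT (k := k) (a := b) (b := a) (w := w) hU hUaxis
        (fun l => ⟨1, l, 1, 0, one_ne_zero, one_ne_zero, Or.inr fun p => ⟨rfl, rfl⟩⟩) ho.symm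
        (fun i p hp => ?_) (fun h0 => hY ?_) ?_
      · rw [hx i p hp]; ring
      · linear_combination -h0
      · linear_combination -hX
  · exact ToricKahlerSurface.hasNormalForm_OT hU hUaxis ho hx hc.1 hc.2

end
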